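/- **Conventions.** $G$ is a countable group. A $G$-system $(G,X,\mu)$ is a probability space $(X,\mu)$ with an action of $G$ by measurable, $\mu$-preserving transformations. Partitions are ordered, measurable and at most countable (empty atoms are allowed), and $H(\alpha)=-\sum_{A\in\alpha}\mu(A)\log\mu(A)$. We write $\alpha\ge\beta$ if every atom of $\alpha$ is contained, up to a null set, in an atom of $\beta$. A *sofic approximation* to $G$ is a sequence $\Sigma=(\sigma_i)_{i\ge1}$ of maps $\sigma_i:G\to\mathrm{Sym}(m_i)$ with $m_i\ge1$ and $m_i\to\infty$, for which there are sets $F_1\subset F_2\subset\cdots$ with $\bigcup_iF_i=G$ and reals $\epsilon_i\to0$ such that, for every $i$, at least $(1-\epsilon_i)m_i$ points $v\in\{1,\dots,m_i\}$ satisfy, for all $f,f'\in F_i$, $\sigma_i(f)\sigma_i(f')v=\sigma_i(ff')v$, and $\sigma_i(f)v\ne\sigma_i(f')v$ if $f\neq f'$. *Entropy.* Let $F\subset G$ be finite and $\sigma:G\to\mathrm{Sym}(m)$. For a finite partition $\alpha=(A_1,\dots,A_u)$ of $X$ and $\epsilon>0$, let $\mathcal{AP}(\sigma,\alpha:F,\epsilon)$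 be the set of ordered partitions $\bar\alpha=(\bar A_1,\dots,\bar A_u)$ of $\{1,\dots,m\}$ (empty atoms allowed) with $$\sum_{\phi:F\to\{1,\dots,u\}}\Big|\mu\Big(\bigcap_{f\in F}fA_{\phi(f)}\Big)-\frac1m\Big|\bigcap_{f\in F}\sigma(f)\bar A_{\phi(f)}\Big|\Big|\le\epsilon .$$ With $\log 0=-\infty$, put $$H(\Sigma,\alpha:F)=\lim_{\epsilon\to0}\ \limsup_{i\to\infty}\frac1{m_i}\log|\mathcal{AP}(\sigma_i,\alpha:F,\epsilon)| .$$ For a countable partition $\alpha$, let $H(\Sigma,\alpha:F)$ be the infimum of $\lim_nH(\Sigma,\alpha_n:F)$ over all chains of $\alpha$ for which this limit exists, where a chain of $\alpha$ is a sequence of finite partitions $\alpha_1\le\alpha_2\le\cdots\le\alpha$ with $\bigvee_n\alpha_n=\alpha$ up to null sets. Put $h(\Sigma,\alpha)=\inf_FH(\Sigma,\alpha:F)$, the infimum being over the finite sets $F\subset G$. The partition $\alpha$ is generating if every measurable set agrees up to a null set with a member of the smallest $G$-invariant $\sigma$-algebra containing the atoms of $\alpha$. The statement that $h(\Sigma,G,X,\mu)$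 is defined and equals $c\in[-\infty,\infty]$ means that $X$ has a generating partition of finite entropy and that $h(\Sigma,\alpha)=c$ for every such partition $\alpha$. *Bernoulli shifts.* For a standard Borel probability space $(K,\kappa)$, let $H(\kappa)=-\sum_{k\in K}\kappa(\{k\})\log\kappa(\{k\})$ if $\kappa$ is concentrated on a countable set, and $H(\kappa)=\infty$ otherwise. $G$ acts on $(K^G,\kappa^G)$ by $(gx)(f)=x(g^{-1}f)$. The canonical partition is $\beta=\{B_k\}_{k\in K}$ with $B_k=\{x\in K^G: x(e)=k\}$. The group $G$ acts diagonally on products, and $\alpha\times\beta=\{A\times B: A\in\alpha,\ B\in\beta\}$. **Theorem.** Let $\Sigma$ be a sofic approximation to the countable group $G$. 1. Let $K$ be a finite or countably infinite set, $\kappa$ a probability measure on $K$ with $H(\kappa)<\infty$, and $\beta$ the canonical partition of $K^G$. Let $(G,X,\mu)$ be any $G$-system. (a) For every partition $\alpha$ of $X$ with $H(\alpha)<\infty$ and every non-empty finite $F\subset G$, $$H(\Sigma,\alpha\times\beta:F)=H(\Sigma,\alpha:F)+H(\kappa).$$ If $\alpha$ and $K$ are finite, this holds with both readings of $H(\Sigma,\cdot:F)$,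 the direct one for finite partitions and the one through chains. (b) If $(G,X,\mu)$ has a generating partition of finite entropy, then $h(\Sigma,G,X,\mu)$ and $h(\Sigma,G,X\times K^G,\mu\times\kappa^G)$ are defined and $$h(\Sigma,G,X\times K^G,\mu\times\kappa^G)=h(\Sigma,G,X,\mu)+H(\kappa).$$ 2. For every standard Borel probability space $(K,\kappa)$ with $H(\kappa)<\infty$, $h(\Sigma,G,K^G,\kappa^G)$ is defined and equals $H(\kappa)$. -/

import Mathlib

open MeasureTheory Filter Topology
open scoped ENNReal Pointwise

noncomputable section

namespace SoficEntropy

/-! ### Sofic approximations -/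

/-- For a map `σ : G → Sym(m)` and `F ⊆ G`, the set `V(F)` of points `v` at which `σ` behaves like
a free action of `G` as far as `F` can see. -/
def goodSet {G : Type*} [Group G] {m : ℕ} (σ : G → Equiv.Perm (Fin m)) (F : Set G) :
    Set (Fin m) :=
  {v | ∀ f₁ ∈ F, ∀ f₂ ∈ F,
    σ f₁ (σ f₂ v) = σ (f₁ * f₂) v ∧ (f₁ ≠ f₂ → σ f₁ v ≠ σ f₂ v)}

/-- `σ` is an `(F, ε)`-approximation to `G`: `|V(F)| ≥ (1 - ε) m`. -/
def IsApproximation {G : Type*} [Group G] {m : ℕ} (σ : G → Equiv.Perm (Fin m)) (F : Set G)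
    (ε : ℝ) : Prop :=
  (1 - ε) * (m : ℝ) ≤ ((goodSet σ F).ncard : ℝ)

/-- A map sequence for `G`: arbitrary maps `σ i : G → Sym(m i)` (not assumed to be homomorphisms)
with `m i ≥ 1` and `m i → ∞`. -/
structure MapSequence (G : Type*) where
  m : ℕ → ℕ
  one_le_m : ∀ i, 1 ≤ m i
  tendsto_m : Tendsto m atTop atTop
  σ : ∀ i, G → Equiv.Perm (Fin (m i))

/-- A map sequence is a sofic approximation to `G` if `σ i` is an `(F i, ε i)`-approximation, where
the `F i` increase to `G` and `ε i → 0`. -/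
def MapSequence.IsSofic {G : Type*} [Group G] (S : MapSequence G) : Prop :=
  ∃ (F : ℕ → Set G) (ε : ℕ → ℝ),
    (∀ i, F i ⊆ F (i + 1)) ∧ (⋃ i, F i) = Set.univ ∧ Tendsto ε atTop (𝓝 0) ∧
      ∀ i, IsApproximation (S.σ i) (F i) (ε i)

/-! ### Partitions

An ordered partition of `X` with labels in `ι` is given by its label function `α : X → ι`; its atoms
are the sets `α ⁻¹' {i}`, some of which may be empty. -/

/-- All atoms of `α` are measurable. -/
def IsMeasurablePartition {X ι : Type*} [MeasurableSpace X] (α : X → ι) : Prop :=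
  ∀ i, MeasurableSet (α ⁻¹' {i})

/-- The Shannon entropy `H(α) = -∑ μ(A) log μ(A)`, with values in `[0, ∞]`. -/
def partitionEntropy {X ι : Type*} [MeasurableSpace X] (μ : Measure X) (α : X → ι) : ℝ≥0∞ :=
  ∑' i, ENNReal.ofReal (Real.negMulLog (μ.real (α ⁻¹' {i})))

/-- `α` refines `β`: every atom of `α` lies in an atom of `β` up to a null set. -/
def Refines {X ι κ : Type*} [MeasurableSpace X] (μ : Measure X) (α : X → ι) (β : X → κ) : Prop :=
  ∀ i, ∃ j, μ (α ⁻¹' {i} \ β ⁻¹' {j}) = 0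

/-- A chain of `α`: finite partitions `α₀ ≤ α₁ ≤ ⋯ ≤ α` whose join is `α`. The join of all `αₙ` is
the partition with label function `x ↦ (αₙ x)ₙ`; it is coarser than `α` because every `αₙ` is, so
the join equals `α` up to null sets iff it refines `α`. -/
structure IsChain {X ι : Type*} [MeasurableSpace X] (μ : Measure X) (α : X → ι) (u : ℕ → ℕ)
    (a : ∀ n, X → Fin (u n)) : Prop where
  measurable : ∀ n, IsMeasurablePartition (a n)
  mono : ∀ n, Refines μ (a (n + 1)) (a n)
  le : ∀ n, Refines μ α (a n)
  join : Refines μ (fun (x : X) (n : ℕ) => a n x) α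

/-- `α` is generating: every measurable set agrees up to a null set with a member of the smallest
`G`-invariant σ-algebra containing the atoms of `α`, that is, of the σ-algebra generated by the
translates of the atoms. -/
def IsGenerating (G : Type*) {X ι : Type*} [Group G] [MulAction G X] [MeasurableSpace X]
    (μ : Measure X) (α : X → ι) : Prop :=
  ∀ A : Set X, MeasurableSet A → ∃ A' : Set X,
    MeasurableSet[MeasurableSpace.generateFrom
      {s : Set X | ∃ (g : G) (i : ι), s = g • (α ⁻¹' {i})}] A' ∧ μ (symmDiff A A') = 0

/-! ### Entropy with respect to a map sequence -/

section

variable {G X ι : Type*} [Group G] [MulAction G X] [MeasurableSpace X]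

/-- `d_F(α, β) = ∑_{φ : F → ι} |μ(A_φ) - ζ(B_φ)|` for a partition `α` of `X` and a partition `β` of
`{1, …, m}`, where `A_φ = ⋂ f A_{φ(f)}`, `B_φ = ⋂ σ(f) B_{φ(f)}` and `ζ` is uniform. -/
def partDist (μ : Measure X) {m : ℕ} (σ : G → Equiv.Perm (Fin m)) (F : Finset G)
    (α : X → ι) (β : Fin m → ι) : ℝ :=
  ∑' φ : F → ι,
    |μ.real (⋂ f : F, (f : G) • (α ⁻¹' {φ f})) -
      ((⋂ f : F, σ (f : G) '' (β ⁻¹' {φ f})).ncard : ℝ) / (m : ℝ)|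

/-- The set `AP(σ, α : F, ε)` of approximating partitions. -/
def approxPartitions (μ : Measure X) {m : ℕ} (σ : G → Equiv.Perm (Fin m)) (F : Finset G)
    (α : X → ι) (ε : ℝ) : Set (Fin m → ι) :=
  {β | partDist μ σ F α β ≤ ε}

/-- `H(Σ, α : F, ε) = limsup (1 / mᵢ) log |AP(σᵢ, α : F, ε)|` for a finite partition `α`, with
`log 0 = -∞`. -/
def finEntropyEps (S : MapSequence G) (μ : Measure X) (α : X → ι) (F : Finset G) (ε : ℝ) : EReal :=
  limsup (fun i =>
    ENNReal.log ((approxPartitions μ (S.σ i) F α ε).encard : ℝ≥0∞) / ((S.m i : ℝ) : EReal)) atTop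

/-- `H(Σ, α : F)` for a finite partition `α`; the limit as `ε → 0` is the infimum over `ε > 0`
because `H(Σ, α : F, ε)` is monotone in `ε`. -/
def finEntropyAt (S : MapSequence G) (μ : Measure X) (α : X → ι) (F : Finset G) : EReal :=
  ⨅ (ε : ℝ) (_ : 0 < ε), finEntropyEps S μ α F ε

/-- `H(Σ, α : F)` for a countable partition `α`: the infimum of `lim H(Σ, αₙ : F)` over the chains
`(αₙ)` of `α`. -/
def entropyAt (S : MapSequence G) (μ : Measure X) (α : X → ι) (F : Finset G) : EReal :=
  sInf {L : EReal | ∃ (u : ℕ → ℕ) (a : ∀ n, X → Fin (u n)), IsChain μ α u a ∧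
    Tendsto (fun n => finEntropyAt S μ (a n) F) atTop (𝓝 L)}

/-- The mean `Σ`-entropy `h(Σ, α) = inf_F H(Σ, α : F)`. -/
def meanEntropy (S : MapSequence G) (μ : Measure X) (α : X → ι) : EReal :=
  ⨅ F : Finset G, entropyAt S μ α F

end

/-- `α` is a finite-entropy generating countable partition (with labels in `ℕ`). -/
def IsFiniteEntropyGenerator (G : Type*) {X : Type*} [Group G] [MulAction G X] [MeasurableSpace X]
    (μ : Measure X) (α : X → ℕ) : Prop :=
  IsMeasurablePartition α ∧ partitionEntropy μ α < ⊤ ∧ IsGenerating G μ α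

/-- The entropy `h(Σ, G, X, μ)` is defined and equal to `c`: finite-entropy generating partitions
exist, and all of them have mean `Σ`-entropy `c`. -/
def HasSoficEntropy {G X : Type*} [Group G] [MulAction G X] [MeasurableSpace X]
    (S : MapSequence G) (μ : Measure X) (c : EReal) : Prop :=
  (∃ α : X → ℕ, IsFiniteEntropyGenerator G μ α) ∧
    ∀ α : X → ℕ, IsFiniteEntropyGenerator G μ α → meanEntropy S μ α = c

/-! ### Bernoulli shifts -/

open Classical in
/-- The entropy `H(κ)` of a probability measure: the Shannon entropy of its atoms if `κ` is
concentrated on a countable set, and `∞` otherwise. -/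
def baseEntropy {K : Type*} [MeasurableSpace K] (κ : Measure K) : ℝ≥0∞ :=
  if ∃ K' : Set K, K'.Countable ∧ κ K' = 1 then
    ∑' k, ENNReal.ofReal (Real.negMulLog (κ.real {k}))
  else ⊤

/-- The space `K^G`. -/
def Shift (G K : Type*) : Type _ := G → K

instance (G K : Type*) [MeasurableSpace K] : MeasurableSpace (Shift G K) :=
  inferInstanceAs (MeasurableSpace (G → K))

/-- The shift action `(g x)(f) = x(g⁻¹ f)`. -/
instance (G K : Type*) [Group G] : MulAction G (Shift G K) where
  smul g x := fun f => x (g⁻¹ * f)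
  one_smul x := funext fun f => by
    change x (1⁻¹ * f) = x f
    simp
  mul_smul g h x := funext fun f => by
    change x ((g * h)⁻¹ * f) = x (h⁻¹ * (g⁻¹ * f))
    simp [mul_assoc]

/-- The product measure `κ^G`. -/
def bernoulliMeasure (G : Type*) {K : Type*} [MeasurableSpace K] (κ : Measure K)
    [IsProbabilityMeasure κ] : Measure (Shift G K) :=
  Measure.infinitePi (fun _ : G => κ)

/-- The canonical partition `{B_k}` of `K^G`, `B_k = {x | x(e) = k}`. -/
def canonicalPartition (G K : Type*) [Group G] : Shift G K → K := fun x => x 1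

/-- The partition `α × β = {A × B}` of `X × Y`. -/
def prodPartition {X Y ι κ : Type*} (α : X → ι) (β : Y → κ) : X × Y → ι × κ :=
  fun p => (α p.1, β p.2)

end SoficEntropy

end

open SoficEntropy

/-!
For finite partitions the product formula is a count. Over a fixed model of `α`, a model of `α × β`
is a word in the labels of `β` with letter frequencies close to `κ`, and there are at most
`exp (m (H(κ) + o(1)))` of these. Conversely, a word chosen at random with independent letters of
law `κ` extends a given model of `α` to a model of `α × β` with high probability: since the
`F`-names of all but a few pairs of points involve disjoint sets of letters, the frequencies of
names have small variance. As each word of typical letter frequencies has probability about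
`exp (-m H(κ))`, there are at least `exp (m (H(κ) - o(1)))` such extensions.

For a countable partition of finite entropy, refining `α'` to `α` raises the entropy with respect to
`F` by at most the conditional Shannon entropy `H(α | α')`, which tends to `0` along the coarsenings
of a chain. Hence all chains have the same limit, and the product formula passes to the limit along
truncations.

The mean entropy does not depend on the generator. If `α` is generating, a finite coarsening of `β`
is approximately a function of the `D`-names of a finite coarsening of `α`, and vice versa. These
codes carry models of one partition to models of the other, and what is lost is again a small
conditional entropy. For a Bernoulli shift, the canonical partition is therefore enough.
-/

noncomputable section

namespace SoficEntropy

open ProbabilityTheory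

/-! ### Laws and the number of words with given letter frequencies -/

section Law

variable {X Y A B : Type*} [MeasurableSpace X] [MeasurableSpace Y]

/-- The distribution of a label function: `law μ g a` is the measure of the atom of `g` with label
`a`. -/
def law (μ : Measure X) (g : X → A) (a : A) : ℝ := μ.real (g ⁻¹' {a})

/-- The `ℓ¹` distance of two functions, used to compare laws on a finite set; it is written as a
`tsum` so that spaces of names `F → A` need no `Fintype` instance. -/
def l1Dist (p q : A → ℝ) : ℝ := ∑' a, |p a - q a|

open Classical in
/-- The image of a weight function under a map of labels: the weight of `b` is the total weight of
its fibre. -/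
def pushforward [Fintype A] (π : A → B) (p : A → ℝ) (b : B) : ℝ := ∑ a with π a = b, p a

/-- The Shannon entropy of a weight function on a finite set, which need not be normalized. -/
def shannonEntropy [Fintype A] (p : A → ℝ) : ℝ := ∑ a, Real.negMulLog (p a)

theorem law_nonneg (μ : Measure X) (g : X → A) (a : A) : 0 ≤ law μ g a := measureReal_nonneg

theorem IsMeasurablePartition.measurableSet_preimage [Countable A] {g : X → A}
    (hg : IsMeasurablePartition g) (s : Set A) : MeasurableSet (g ⁻¹' s) := by
  rw [← Set.biUnion_preimage_singleton]
  exact MeasurableSet.biUnion s.to_countable fun a _ => hg a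

theorem IsMeasurablePartition.comp [Countable A] {g : X → A} (hg : IsMeasurablePartition g)
    (π : A → B) : IsMeasurablePartition (π ∘ g) :=
  fun b => hg.measurableSet_preimage (π ⁻¹' {b})

theorem isMeasurablePartition_of_discrete [DiscreteMeasurableSpace X] (g : X → A) :
    IsMeasurablePartition g :=
  fun _ => MeasurableSet.of_discrete

theorem law_comp_of_injective {π : A → B} (hπ : Function.Injective π) (μ : Measure X) (g : X → A)
    (a : A) : law μ (π ∘ g) (π a) = law μ g a := by
  rw [law, law, Set.preimage_comp, ← Set.image_singleton, hπ.preimage_image]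

theorem l1Dist_eq_sum [Fintype A] (p q : A → ℝ) : l1Dist p q = ∑ a, |p a - q a| :=
  tsum_fintype _

theorem l1Dist_self (p : A → ℝ) : l1Dist p p = 0 := by simp [l1Dist]

theorem l1Dist_triangle [Finite A] (p q r : A → ℝ) : l1Dist p r ≤ l1Dist p q + l1Dist q r := by
  have := Fintype.ofFinite A
  simp only [l1Dist_eq_sum, ← Finset.sum_add_distrib]
  exact Finset.sum_le_sum fun a _ => abs_sub_le _ _ _

theorem abs_sub_le_l1Dist [Finite A] (p q : A → ℝ) (a : A) : |p a - q a| ≤ l1Dist p q := by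
  have := Fintype.ofFinite A
  rw [l1Dist_eq_sum]
  exact Finset.single_le_sum (f := fun a => |p a - q a|) (fun _ _ => abs_nonneg _)
    (Finset.mem_univ a)

section Fintype

variable [Fintype A]

theorem law_comp (μ : Measure X) [IsFiniteMeasure μ] {g : X → A} (hg : IsMeasurablePartition g)
    (π : A → B) : law μ (π ∘ g) = pushforward π (law μ g) := by
  classical
  ext b
  simp only [pushforward, law]
  rw [sum_measureReal_preimage_singleton _ fun a _ => hg a]
  congr 1
  ext
  simp

theorem sum_law (μ : Measure X) [IsProbabilityMeasure μ] {g : X → A}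
    (hg : IsMeasurablePartition g) : ∑ a, law μ g a = 1 := by
  simp only [law]
  rw [sum_measureReal_preimage_singleton _ fun a _ => hg a]
  simp

theorem sum_pushforward_mul [Fintype B] (π : A → B) (p : A → ℝ) (h : B → ℝ) :
    ∑ b, pushforward π p b * h b = ∑ a, p a * h (π a) := by
  classical
  simp only [pushforward, Finset.sum_mul, Finset.sum_filter, ite_mul, zero_mul]
  rw [Finset.sum_comm]
  simp

theorem abs_sum_mul_sub_sum_mul_le (p q h : A → ℝ) :
    |∑ a, p a * h a - ∑ a, q a * h a| ≤ l1Dist p q * ∑ a, |h a| := by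
  rw [← Finset.sum_sub_distrib, Finset.mul_sum]
  refine (Finset.abs_sum_le_sum_abs _ _).trans (Finset.sum_le_sum fun a _ => ?_)
  rw [← sub_mul, abs_mul]
  exact mul_le_mul_of_nonneg_right (abs_sub_le_l1Dist p q a) (abs_nonneg _)

theorem l1Dist_pushforward_le [Finite B] (π : A → B) (p q : A → ℝ) :
    l1Dist (pushforward π p) (pushforward π q) ≤ l1Dist p q := by
  classical
  have := Fintype.ofFinite B
  rw [l1Dist_eq_sum, l1Dist_eq_sum, ← Finset.sum_fiberwise Finset.univ π fun a => |p a - q a|]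
  simp only [pushforward, ← Finset.sum_sub_distrib]
  exact Finset.sum_le_sum fun b _ => Finset.abs_sum_le_sum_abs _ _

end Fintype

theorem l1Dist_law_comp_le [Finite A] [Finite B] (μ : Measure X) [IsFiniteMeasure μ] (ν : Measure Y)
    [IsFiniteMeasure ν] {g : X → A} (hg : IsMeasurablePartition g) {h : Y → A}
    (hh : IsMeasurablePartition h) (π : A → B) :
    l1Dist (law μ (π ∘ g)) (law ν (π ∘ h)) ≤ l1Dist (law μ g) (law ν h) := by
  have := Fintype.ofFinite A
  have := Fintype.ofFinite B
  rw [law_comp μ hg, law_comp ν hh]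
  exact l1Dist_pushforward_le π _ _

theorem l1Dist_law_le_measureReal_ne [Finite A] (μ : Measure X) [IsFiniteMeasure μ] {g h : X → A}
    (hg : IsMeasurablePartition g) (hh : IsMeasurablePartition h) :
    l1Dist (law μ g) (law μ h) ≤ 2 * μ.real {x | g x ≠ h x} := by
  have := Fintype.ofFinite A
  set D := {x | g x ≠ h x}
  have sum_inter {k : X → A} (hk : IsMeasurablePartition k) :
      ∑ a, μ.real (k ⁻¹' {a} ∩ D) = μ.real D := by
    simp_rw [← measureReal_restrict_apply (hk _)]
    rw [sum_measureReal_preimage_singleton _ fun a _ => hk a]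
    simp
  have atom_le (a : A) : |law μ g a - law μ h a| ≤
      μ.real (g ⁻¹' {a} ∩ D) + μ.real (h ⁻¹' {a} ∩ D) := by
    refine (abs_measureReal_sub_le_measureReal_symmDiff
      (hg a).nullMeasurableSet (hh a).nullMeasurableSet).trans
      ((measureReal_mono ?_).trans (measureReal_union_le _ _))
    rintro x (⟨rfl, hx⟩ | ⟨rfl, hx⟩)
    exacts [.inl ⟨rfl, Ne.symm hx⟩, .inr ⟨rfl, hx⟩]
  calc l1Dist (law μ g) (law μ h)
    _ = ∑ a, |law μ g a - law μ h a| := l1Dist_eq_sum _ _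
    _ ≤ ∑ a, (μ.real (g ⁻¹' {a} ∩ D) + μ.real (h ⁻¹' {a} ∩ D)) :=
        Finset.sum_le_sum fun a _ => atom_le a
    _ = 2 * μ.real D := by rw [Finset.sum_add_distrib, sum_inter hg, sum_inter hh, two_mul]

variable [Fintype A]

theorem continuous_shannonEntropy : Continuous (shannonEntropy : (A → ℝ) → ℝ) :=
  continuous_finsetSum _ fun a _ => Real.continuous_negMulLog.comp (continuous_apply a)

theorem exists_forall_l1Dist_le_abs_shannonEntropy_sub_lt (p : A → ℝ) {η : ℝ} (hη : 0 < η) :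
    ∃ ε > 0, ∀ q : A → ℝ, l1Dist p q ≤ ε → |shannonEntropy q - shannonEntropy p| < η := by
  obtain ⟨δ, hδ, h⟩ := Metric.continuous_iff.1 (continuous_shannonEntropy (A := A)) p η hη
  refine ⟨δ / 2, half_pos hδ, fun q hq => h q (lt_of_le_of_lt ?_ (half_lt_self hδ))⟩
  rw [dist_comm]
  exact (dist_pi_le_iff (half_pos hδ).le).2 fun a => (abs_sub_le_l1Dist p q a).trans hq

theorem shannonEntropy_law_comp_of_injective [Fintype B] {π : A → B} (hπ : Function.Injective π)
    (μ : Measure X) (g : X → A) :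
    shannonEntropy (law μ (π ∘ g)) = shannonEntropy (law μ g) := by
  refine (Fintype.sum_of_injective π hπ _ _ (fun b hb => ?_) fun a => ?_).symm
  · have : π ∘ g ⁻¹' {b} = ∅ :=
      Set.eq_empty_of_forall_notMem fun x hx => hb ⟨g x, hx⟩
    simp [law, this]
  · rw [law_comp_of_injective hπ]

theorem shannonEntropy_mul [Fintype B] {p : A → ℝ} {q : B → ℝ} (hp : ∑ a, p a = 1)
    (hq : ∑ b, q b = 1) :
    shannonEntropy (fun x : A × B => p x.1 * q x.2) = shannonEntropy p + shannonEntropy q := by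
  simp only [shannonEntropy, Fintype.sum_prod_type, Real.negMulLog_mul, Finset.sum_add_distrib,
    ← Finset.sum_mul, ← Finset.mul_sum, hp, hq, one_mul]

theorem shannonEntropy_eq_neg_sum_mul_log (p : A → ℝ) :
    shannonEntropy p = -∑ a, p a * Real.log (p a) := by
  simp [shannonEntropy, Real.negMulLog]

end Law

section Uniform

variable {m : ℕ} {A : Type*}

/-- The uniform measure on the finite model space `{1, …, m}`. -/
abbrev uniformMeasure (m : ℕ) : Measure (Fin m) := uniformOn Set.univ

theorem uniformMeasure_real (s : Set (Fin m)) : (uniformMeasure m).real s = s.ncard / m := by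
  have hcount : Measure.count s = (s.ncard : ℝ≥0∞) := by
    rw [Measure.count_apply MeasurableSet.of_discrete, ← Set.Finite.cast_ncard_eq (Set.toFinite s)]
    exact ENat.toENNReal_coe _
  rw [measureReal_def, uniformOn_univ, hcount]
  simp

theorem uniformMeasure_real_image (e : Equiv.Perm (Fin m)) (s : Set (Fin m)) :
    (uniformMeasure m).real (e '' s) = (uniformMeasure m).real s := by
  rw [uniformMeasure_real, uniformMeasure_real, Set.ncard_image_of_injective _ e.injective]

theorem law_uniformMeasure_comp_perm (e : Equiv.Perm (Fin m)) (g : Fin m → A) :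
    law (uniformMeasure m) (g ∘ e) = law (uniformMeasure m) g := by
  ext a
  rw [law, ← uniformMeasure_real_image e, Set.preimage_comp, Equiv.image_preimage, law]

open Classical in
theorem law_uniformMeasure_eq_sum (g : Fin m → A) (a : A) :
    law (uniformMeasure m) g a = (∑ v, if g v = a then (1 : ℝ) else 0) / m := by
  rw [law, uniformMeasure_real, Finset.sum_boole, ← Set.ncard_coe_finset]
  congr 3
  ext
  simp

theorem sum_comp_eq_mul_sum_law [NeZero m] [Fintype A] (g : Fin m → A) (h : A → ℝ) :
    ∑ v, h (g v) = m * ∑ a, law (uniformMeasure m) g a * h a := by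
  classical
  have hm : (m : ℝ) ≠ 0 := NeZero.ne _
  simp only [law_uniformMeasure_eq_sum, div_mul_eq_mul_div, ← Finset.sum_div, Finset.sum_mul]
  rw [mul_div_cancel₀ _ hm, Finset.sum_comm]
  simp

end Uniform

section Count

variable {A B : Type*} [Fintype A]

theorem exists_abs_log_prod_sub_le (p w : A → ℝ) {η : ℝ} (hη : 0 < η) :
    ∃ ε > 0, ∀ (m : ℕ) [NeZero m] (a : Fin m → A), l1Dist p (law (uniformMeasure m) a) ≤ ε →
      (∀ v, w (a v) ≠ 0) →
      |Real.log (∏ v, w (a v)) - m * ∑ x, p x * Real.log (w x)| ≤ m * η := by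
  set M := ∑ x, |Real.log (w x)|
  have hM : 0 ≤ M := Finset.sum_nonneg fun _ _ => abs_nonneg _
  refine ⟨η / (M + 1), by positivity, fun m _ a ha hw => ?_⟩
  rw [Real.log_prod fun v _ => hw v, sum_comp_eq_mul_sum_law a fun x => Real.log (w x), ← mul_sub,
    abs_mul, Nat.abs_cast, abs_sub_comm]
  refine mul_le_mul_of_nonneg_left ?_ (Nat.cast_nonneg m)
  calc _ ≤ l1Dist p (law (uniformMeasure m) a) * M := abs_sum_mul_sub_sum_mul_le _ _ _
    _ ≤ η / (M + 1) * (M + 1) := by gcongr; linarith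
    _ = η := by field_simp

theorem exists_forall_l1Dist_le_prod_le (p : A → ℝ) (hp : ∀ a, 0 ≤ p a) {η : ℝ} (hη : 0 < η) :
    ∃ ε > 0, ∀ (m : ℕ) [NeZero m] (a : Fin m → A), l1Dist p (law (uniformMeasure m) a) ≤ ε →
      ∏ v, p (a v) ≤ Real.exp (-(m * (shannonEntropy p - η))) := by
  obtain ⟨ε, hε, hlog⟩ := exists_abs_log_prod_sub_le p p hη
  refine ⟨ε, hε, fun m _ a ha => ?_⟩
  by_cases h0 : ∀ v, p (a v) ≠ 0
  · have hpos : 0 < ∏ v, p (a v) := Finset.prod_pos fun v _ => (hp _).lt_of_ne' (h0 v)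
    rw [← Real.log_le_iff_le_exp hpos, shannonEntropy_eq_neg_sum_mul_log]
    linarith [(abs_le.1 (hlog m a ha h0)).2]
  · push Not at h0
    obtain ⟨v, hv⟩ := h0
    rw [Finset.prod_eq_zero (Finset.mem_univ v) hv]
    positivity

theorem tendsto_sum_mul_log {l : Filter ℝ} (r : A → ℝ) (s : ℝ → A → ℝ)
    (hs : ∀ a, Tendsto (fun δ => s δ a) l (𝓝 (r a))) :
    Tendsto (fun δ => ∑ a, r a * Real.log (s δ a)) l (𝓝 (-shannonEntropy r)) := by
  rw [shannonEntropy_eq_neg_sum_mul_log, neg_neg]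
  refine tendsto_finsetSum _ fun a _ => ?_
  by_cases h0 : r a = 0
  · simpa [h0] using tendsto_const_nhds
  · exact ((hs a).log h0).const_mul _

theorem pushforward_pos {π : A → B} {q : A → ℝ} (hq : ∀ a, 0 < q a) (a : A) :
    0 < pushforward π q (π a) := by
  unfold pushforward
  exact Finset.sum_pos (fun a _ => hq a) ⟨a, by simp⟩

theorem pushforward_div_pushforward_le_one (π : A → B) (q : A → ℝ) (b : B) :
    pushforward π (fun a => q a / pushforward π q (π a)) b ≤ 1 := by
  have : pushforward π (fun a => q a / pushforward π q (π a)) b =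
      pushforward π q b / pushforward π q b := by
    rw [pushforward, pushforward, Finset.sum_div]
    refine Finset.sum_congr rfl fun a ha => ?_
    obtain rfl : π a = b := by simpa using ha
    rfl
  rw [this]
  exact div_self_le_one _

open Classical in
theorem sum_prod_le_one_of_pushforward_le_one {V : Type*} [Fintype V] (π : A → B) {w : A → ℝ}
    (hw0 : ∀ a, 0 ≤ w a) (hw : ∀ b, pushforward π w b ≤ 1) (b : V → B) :
    ∑ a : V → A with π ∘ a = b, ∏ v, w (a v) ≤ 1 := by
  have hfiber : ({a : V → A | π ∘ a = b} : Finset (V → A)) =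
      Fintype.piFinset fun v => {x | π x = b v} := by
    ext
    simp [funext_iff]
  rw [hfiber, ← Finset.prod_univ_sum]
  exact Finset.prod_le_one (fun v _ => Finset.sum_nonneg fun a _ => hw0 a) fun v _ => hw _

variable [Fintype B]

-- The weights are the conditional probabilities of `p + δ` given the image under `π`; the
-- perturbation keeps them positive where `p` vanishes.
theorem exists_weights_neg_sum_mul_log_lt (π : A → B) (p : A → ℝ) (hp : ∀ a, 0 ≤ p a) {η : ℝ}
    (hη : 0 < η) :
    ∃ w : A → ℝ, (∀ a, 0 < w a) ∧ (∀ b, pushforward π w b ≤ 1) ∧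
      -∑ a, p a * Real.log (w a) <
        shannonEntropy p - shannonEntropy (pushforward π p) + η := by
  let q : ℝ → A → ℝ := fun δ a => p a + δ
  have q_pos {δ : ℝ} (hδ : 0 < δ) (a : A) : 0 < q δ a := add_pos_of_nonneg_of_pos (hp a) hδ
  have q_tendsto (a : A) : Tendsto (fun δ => q δ a) (𝓝[>] 0) (𝓝 (p a)) := by
    have : Tendsto (fun δ => q δ a) (𝓝 0) (𝓝 (q 0 a)) :=
      (continuous_const.add continuous_id).tendsto 0
    simpa [q] using this.mono_left nhdsWithin_le_nhds
  have hlim : Tendsto (fun δ => -∑ a, p a * Real.log (q δ a / pushforward π (q δ) (π a)))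
      (𝓝[>] 0) (𝓝 (shannonEntropy p - shannonEntropy (pushforward π p))) := by
    have h := (tendsto_sum_mul_log (pushforward π p) (fun δ => pushforward π (q δ))
      fun b => tendsto_finsetSum _ fun a _ => q_tendsto a).sub (tendsto_sum_mul_log p q q_tendsto)
    rw [neg_sub_neg] at h
    refine h.congr' ?_
    filter_upwards [self_mem_nhdsWithin] with δ hδ
    rw [sum_pushforward_mul, ← Finset.sum_sub_distrib, ← Finset.sum_neg_distrib]
    refine Finset.sum_congr rfl fun a _ => ?_
    rw [Real.log_div (q_pos hδ a).ne' (pushforward_pos (q_pos hδ) a).ne']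
    ring
  obtain ⟨δ, hlt, hδ⟩ := ((hlim.eventually_lt_const (lt_add_of_pos_right _ hη)).and
    (self_mem_nhdsWithin (s := Set.Ioi (0 : ℝ)))).exists
  exact ⟨_, fun a => div_pos (q_pos hδ a) (pushforward_pos (q_pos hδ) a),
    pushforward_div_pushforward_le_one π (q δ), hlt⟩

theorem exists_ncard_fiber_le (π : A → B) (p : A → ℝ) (hp : ∀ a, 0 ≤ p a) {η : ℝ} (hη : 0 < η) :
    ∃ ε > 0, ∀ (m : ℕ) [NeZero m] (b : Fin m → B),
      ({a : Fin m → A | π ∘ a = b ∧ l1Dist p (law (uniformMeasure m) a) ≤ ε}.ncard : ℝ) ≤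
        Real.exp (m * (shannonEntropy p - shannonEntropy (pushforward π p) + η)) := by
  classical
  obtain ⟨w, hw0, hw1, hw⟩ := exists_weights_neg_sum_mul_log_lt π p hp (half_pos hη)
  obtain ⟨ε, hε, hlog⟩ := exists_abs_log_prod_sub_le p w (half_pos hη)
  refine ⟨ε, hε, fun m _ b => ?_⟩
  set c := shannonEntropy p - shannonEntropy (pushforward π p) + η
  set T : Finset (Fin m → A) := {a | π ∘ a = b ∧ l1Dist p (law (uniformMeasure m) a) ≤ ε}
  have hT : {a : Fin m → A | π ∘ a = b ∧ l1Dist p (law (uniformMeasure m) a) ≤ ε} = T := by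
    ext
    simp [T]
  rw [hT, Set.ncard_coe_finset]
  have weight_ge (a) (ha : a ∈ T) : Real.exp (-(m * c)) ≤ ∏ v, w (a v) := by
    have hpos : 0 < ∏ v, w (a v) := Finset.prod_pos fun v _ => hw0 _
    rw [← Real.le_log_iff_exp_le hpos]
    have hclose := (abs_le.1 (hlog m a (Finset.mem_filter.1 ha).2.2 fun v => (hw0 _).ne')).1
    have hcond := mul_le_mul_of_nonneg_left hw.le (Nat.cast_nonneg (α := ℝ) m)
    simp only [c]
    linarith
  have weight_sum_le : ∑ a ∈ T, ∏ v, w (a v) ≤ 1 := by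
    refine (Finset.sum_le_sum_of_subset_of_nonneg ?_ fun a _ _ =>
      Finset.prod_nonneg fun v _ => (hw0 _).le).trans
      (sum_prod_le_one_of_pushforward_le_one π (fun a => (hw0 a).le) hw1 b)
    intro a ha
    simp only [T, Finset.mem_filter, Finset.mem_univ, true_and] at ha ⊢
    exact ha.1
  have hcard := (Finset.card_nsmul_le_sum T _ _ weight_ge).trans weight_sum_le
  rwa [nsmul_eq_mul, Real.exp_neg, ← div_eq_mul_inv, div_le_one (Real.exp_pos _)] at hcard

end Count

section Fibers

variable {α β : Type*} [Finite α] {s : Set α} {t : Set β}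

theorem ncard_eq_sum_ncard_fiber [Fintype β] (s : Set α) (f : α → β) :
    s.ncard = ∑ b, {a ∈ s | f a = b}.ncard := by
  classical
  have := Fintype.ofFinite α
  simp only [Set.ncard_eq_toFinset_card']
  rw [Finset.card_eq_sum_card_fiberwise (f := f) (t := Finset.univ) fun a _ => by simp]
  refine Finset.sum_congr rfl fun b _ => congrArg _ ?_
  ext
  simp

variable [Finite β]

theorem ncard_le_ncard_mul_of_fiber_le {f : α → β} (hf : Set.MapsTo f s t) {c : ℝ}
    (hc : ∀ b ∈ t, ({a ∈ s | f a = b}.ncard : ℝ) ≤ c) : (s.ncard : ℝ) ≤ t.ncard * c := by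
  classical
  have := Fintype.ofFinite β
  rw [ncard_eq_sum_ncard_fiber s f, Set.ncard_eq_toFinset_card', ← nsmul_eq_mul, Nat.cast_sum,
    ← Finset.sum_subset (Finset.subset_univ t.toFinset) fun b _ hb => ?_]
  · exact Finset.sum_le_card_nsmul _ _ _ fun b hb => hc b (by simpa using hb)
  · rw [Nat.cast_eq_zero, Set.ncard_eq_zero]
    exact Set.eq_empty_of_forall_notMem fun a ha => hb (by simpa [ha.2] using hf ha.1)

theorem ncard_mul_le_ncard_of_le_fiber {f : α → β} {c : ℝ}
    (hc : ∀ b ∈ t, c ≤ ({a ∈ s | f a = b}.ncard : ℝ)) : t.ncard * c ≤ s.ncard := by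
  classical
  have := Fintype.ofFinite β
  rw [ncard_eq_sum_ncard_fiber s f, Set.ncard_eq_toFinset_card', ← nsmul_eq_mul, Nat.cast_sum]
  refine (Finset.card_nsmul_le_sum _ _ _ fun b hb => hc b (by simpa using hb)).trans
    (Finset.sum_le_sum_of_subset_of_nonneg (Finset.subset_univ _) fun _ _ _ => by positivity)

end Fibers

section GrowthRates

theorem le_of_forall_pos_le_add_coe {a b : EReal} (h : ∀ η : ℝ, 0 < η → a ≤ b + (η : EReal)) :
    a ≤ b := by
  induction b with
  | top => exact le_top
  | bot => simpa using h 1 one_pos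
  | coe b =>
    refine EReal.le_of_forall_lt_iff_le.1 fun z hz => ?_
    have := h (z - b) (sub_pos.2 (by exact_mod_cast hz))
    rwa [← EReal.coe_add, add_sub_cancel] at this

theorem le_iInf_add_coe {ι : Sort*} {a : EReal} {u : ι → EReal} {c : ℝ}
    (h : ∀ i, a ≤ u i + (c : EReal)) : a ≤ (⨅ i, u i) + (c : EReal) :=
  (EReal.sub_le_iff_le_add (.inl (EReal.coe_ne_bot c)) (.inl (EReal.coe_ne_top c))).1
    (le_iInf fun i => EReal.sub_le_of_le_add (h i))

theorem iInf_add_coe {ι : Sort*} (u : ι → EReal) (c : ℝ) :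
    ⨅ i, (u i + (c : EReal)) = (⨅ i, u i) + (c : EReal) :=
  le_antisymm (le_iInf_add_coe fun i => iInf_le _ i)
    (le_iInf fun i => add_le_add_left (iInf_le u i) _)

theorem limsup_add_coe_le {ι : Type*} {l : Filter ι} [l.NeBot] (u : ι → EReal) (c : ℝ) :
    limsup (fun i => u i + (c : EReal)) l ≤ limsup u l + (c : EReal) := by
  have := EReal.limsup_add_le (f := l) (u := u) (v := fun _ => (c : EReal))
    (.inr (by simp)) (.inr (by simp))
  simpa [Pi.add_def] using this

theorem encard_eq_ofReal_ncard {α : Type*} [Finite α] (s : Set α) :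
    ((s.encard : ℕ∞) : ℝ≥0∞) = ENNReal.ofReal s.ncard := by
  rw [← Set.Finite.cast_ncard_eq (Set.toFinite s), ENNReal.ofReal_natCast]
  exact ENat.toENNReal_coe _

theorem log_encard_div_le_add {A B : Type*} [Finite A] [Finite B] {s : Set A} {t : Set B} {m : ℕ}
    [NeZero m] {c : ℝ} (h : (s.ncard : ℝ) ≤ t.ncard * Real.exp (m * c)) :
    ENNReal.log (s.encard : ℝ≥0∞) / ((m : ℝ) : EReal) ≤
      ENNReal.log (t.encard : ℝ≥0∞) / ((m : ℝ) : EReal) + (c : EReal) := by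
  have hm : (0 : EReal) ≤ ((m : ℝ) : EReal) := by exact_mod_cast Nat.cast_nonneg m
  have hc : ((c : ℝ) : EReal) =
      ENNReal.log (ENNReal.ofReal (Real.exp (m * c))) / ((m : ℝ) : EReal) := by
    rw [ENNReal.log_ofReal_of_pos (Real.exp_pos _), Real.log_exp, ← EReal.coe_div,
      mul_div_cancel_left₀ _ (NeZero.ne _)]
  rw [hc, ← EReal.add_div_of_nonneg_right hm, ← ENNReal.log_mul_add, encard_eq_ofReal_ncard,
    encard_eq_ofReal_ncard, ← ENNReal.ofReal_mul (Nat.cast_nonneg _)]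
  exact EReal.div_le_div_right_of_nonneg hm
    (ENNReal.log_monotone (ENNReal.ofReal_le_ofReal h))

instance {G : Type*} (S : MapSequence G) (i : ℕ) : NeZero (S.m i) :=
  ⟨Nat.one_le_iff_ne_zero.1 (S.one_le_m i)⟩

variable {G X Y A B : Type*} [Group G] [MulAction G X] [MeasurableSpace X]
  [MulAction G Y] [MeasurableSpace Y]

theorem finEntropyEps_le_of_ncard_le [Finite A] [Finite B] (S : MapSequence G) {μ : Measure X}
    {ν : Measure Y} {α : X → A} {β : Y → B} {F F' : Finset G} {ε ε' c : ℝ}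
    (h : ∀ᶠ i in atTop, ((approxPartitions μ (S.σ i) F α ε).ncard : ℝ) ≤
      (approxPartitions ν (S.σ i) F' β ε').ncard * Real.exp (S.m i * c)) :
    finEntropyEps S μ α F ε ≤ finEntropyEps S ν β F' ε' + (c : EReal) :=
  (limsup_le_limsup (h.mono fun _ hi => log_encard_div_le_add hi)).trans (limsup_add_coe_le _ c)

theorem finEntropyEps_le_of_subset (S : MapSequence G) {μ : Measure X} {ν : Measure Y} {α : X → A}
    {β : Y → A} {F F' : Finset G} {ε ε' : ℝ}
    (h : ∀ i, approxPartitions μ (S.σ i) F α ε ⊆ approxPartitions ν (S.σ i) F' β ε') :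
    finEntropyEps S μ α F ε ≤ finEntropyEps S ν β F' ε' :=
  limsup_le_limsup (.of_forall fun i => EReal.div_le_div_right_of_nonneg
    (by exact_mod_cast Nat.cast_nonneg (S.m i))
    (ENNReal.log_monotone (ENat.toENNReal_mono (Set.encard_le_encard (h i)))))

end GrowthRates

/-! ### Names and models -/

section Names

variable {G X Y A B : Type*} [Group G] [MulAction G X] [MeasurableSpace X]
  [MulAction G Y] [MeasurableSpace Y]

/-- The `F`-name of a point `x`: the labels of the points `f⁻¹ x` for `f ∈ F`. The atoms of this
partition are the sets `⋂ f A_{φ(f)}`. -/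
def orbitName {X : Type*} [MulAction G X] (F : Finset G) (α : X → A) (x : X) : F → A :=
  fun f => α ((f : G)⁻¹ • x)

/-- The `F`-name of a point `v` of a finite model: the labels of the points `σ(f)⁻¹ v` for
`f ∈ F`. The atoms of this partition are the sets `⋂ σ(f) B_{φ(f)}`. -/
def modelName {G : Type*} {m : ℕ} (σ : G → Equiv.Perm (Fin m)) (F : Finset G) (β : Fin m → A)
    (v : Fin m) : F → A :=
  fun f => β ((σ f).symm v)

theorem orbitName_preimage {X : Type*} [MulAction G X] (F : Finset G) (α : X → A) (φ : F → A) :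
    orbitName F α ⁻¹' {φ} = ⋂ f : F, (f : G) • (α ⁻¹' {φ f}) := by
  ext
  simp [orbitName, Set.mem_smul_set_iff_inv_smul_mem, funext_iff]

theorem modelName_preimage {G : Type*} {m : ℕ} (σ : G → Equiv.Perm (Fin m)) (F : Finset G)
    (β : Fin m → A) (φ : F → A) :
    modelName σ F β ⁻¹' {φ} = ⋂ f : F, σ (f : G) '' (β ⁻¹' {φ f}) := by
  ext
  simp [modelName, Equiv.image_eq_preimage_symm, funext_iff]

theorem mem_approxPartitions {μ : Measure X} {m : ℕ} {σ : G → Equiv.Perm (Fin m)}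
    {F : Finset G} {α : X → A} {β : Fin m → A} {ε : ℝ} :
    β ∈ approxPartitions μ σ F α ε ↔
      l1Dist (law μ (orbitName F α)) (law (uniformMeasure m) (modelName σ F β)) ≤ ε := by
  simp only [approxPartitions, partDist, Set.mem_ofPred_eq, l1Dist, law, orbitName_preimage,
    modelName_preimage, uniformMeasure_real]

theorem finEntropyAt_congr (S : MapSequence G) {μ : Measure X} {ν : Measure Y}
    {α : X → A} {β : Y → A} {F : Finset G} (h : law μ (orbitName F α) = law ν (orbitName F β)) :
    finEntropyAt S μ α F = finEntropyAt S ν β F := by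
  have approxPartitions_eq {m : ℕ} (σ : G → Equiv.Perm (Fin m)) (ε) :
      approxPartitions μ σ F α ε = approxPartitions ν σ F β ε := by
    ext
    rw [mem_approxPartitions, mem_approxPartitions, h]
  simp only [finEntropyAt, finEntropyEps, approxPartitions_eq]

section Invariant

variable (μ : Measure X) [SMulInvariantMeasure G X μ]

theorem measureReal_smul_ne (α α' : X → A) (g : G) :
    μ.real {x | α (g • x) ≠ α' (g • x)} = μ.real {x | α x ≠ α' x} :=
  congrArg ENNReal.toReal (measure_preimage_smul μ g {x | α x ≠ α' x})

theorem law_smul (α : X → A) (g : G) : law μ (fun x => α (g • x)) = law μ α :=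
  funext fun a => congrArg ENNReal.toReal (measure_preimage_smul μ g (α ⁻¹' {a}))

theorem measureReal_orbitName_ne_le [IsFiniteMeasure μ] (F : Finset G) (α α' : X → A) :
    μ.real {x | orbitName F α x ≠ orbitName F α' x} ≤ F.card * μ.real {x | α x ≠ α' x} := by
  have hsubset : {x | orbitName F α x ≠ orbitName F α' x} ⊆
      ⋃ f ∈ F, {x | α (f⁻¹ • x) ≠ α' (f⁻¹ • x)} := by
    intro x hx
    obtain ⟨f, hf⟩ := Function.ne_iff.1 hx
    exact Set.mem_biUnion f.2 hf
  refine (measureReal_mono hsubset (measure_ne_top _ _)).trans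
    ((measureReal_biUnion_finset_le _ _).trans ?_)
  simp [measureReal_smul_ne]

end Invariant

variable [MeasurableConstSMul G X]

theorem IsMeasurablePartition.orbitName {α : X → A} (hα : IsMeasurablePartition α)
    (F : Finset G) : IsMeasurablePartition (orbitName F α) := by
  intro φ
  rw [orbitName_preimage]
  exact MeasurableSet.iInter fun f => (hα _).const_smul _

theorem finEntropyAt_anti [Finite A] (S : MapSequence G) (μ : Measure X) [IsFiniteMeasure μ]
    {α : X → A} (hα : IsMeasurablePartition α) {F F' : Finset G} (h : F ⊆ F') :
    finEntropyAt S μ α F' ≤ finEntropyAt S μ α F := by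
  refine iInf₂_mono fun _ _ => finEntropyEps_le_of_subset S fun i β hβ => ?_
  rw [mem_approxPartitions] at hβ ⊢
  exact (l1Dist_law_comp_le μ (uniformMeasure (S.m i)) (hα.orbitName F')
    (isMeasurablePartition_of_discrete (modelName (S.σ i) F' β))
    fun φ (f : F) => φ ⟨f, h f.2⟩).trans hβ

variable (μ : Measure X) [IsFiniteMeasure μ] [SMulInvariantMeasure G X μ]

theorem l1Dist_law_orbitName_le [Finite A] (F : Finset G) {α α' : X → A}
    (hα : IsMeasurablePartition α) (hα' : IsMeasurablePartition α') :
    l1Dist (law μ (orbitName F α)) (law μ (orbitName F α')) ≤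
      2 * (F.card * μ.real {x | α x ≠ α' x}) :=
  (l1Dist_law_le_measureReal_ne μ (hα.orbitName F) (hα'.orbitName F)).trans
    (mul_le_mul_of_nonneg_left (measureReal_orbitName_ne_le μ F α α') zero_le_two)

theorem l1Dist_law_le_l1Dist_law_modelName [Finite A] {m : ℕ}
    (σ : G → Equiv.Perm (Fin m)) {F : Finset G} (hF : F.Nonempty) {α : X → A}
    (hα : IsMeasurablePartition α) (β : Fin m → A) :
    l1Dist (law μ α) (law (uniformMeasure m) β) ≤
      l1Dist (law μ (orbitName F α)) (law (uniformMeasure m) (modelName σ F β)) := by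
  obtain ⟨f, hf⟩ := hF
  let eval : (F → A) → A := fun φ => φ ⟨f, hf⟩
  have h := l1Dist_law_comp_le μ (uniformMeasure m) (hα.orbitName F)
    (isMeasurablePartition_of_discrete (modelName σ F β)) eval
  have eval_orbitName : eval ∘ orbitName F α = fun x => α (f⁻¹ • x) := rfl
  have eval_modelName : eval ∘ modelName σ F β = β ∘ (σ f).symm := rfl
  rwa [eval_orbitName, eval_modelName, law_smul, law_uniformMeasure_comp_perm] at h

-- Over a fixed model `θ ∘ β` of the coarser partition, the number of models `β` of `α` is governed
-- by the conditional entropy of `α` given `θ ∘ α`.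
theorem finEntropyAt_le_of_l1Dist_comp_le [Fintype A] [Fintype B] (S : MapSequence G)
    {α : X → A} {α' : X → B} (hα : IsMeasurablePartition α) (θ : A → B) {F : Finset G}
    (hF : F.Nonempty) {ε : ℝ} (hε : 0 < ε)
    (h : l1Dist (law μ (orbitName F α')) (law μ (orbitName F (θ ∘ α))) ≤ ε / 2) :
    finEntropyAt S μ α F ≤ finEntropyEps S μ α' F ε +
      ((shannonEntropy (law μ α) - shannonEntropy (law μ (θ ∘ α)) : ℝ) : EReal) := by
  refine le_of_forall_pos_le_add_coe fun η hη => ?_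
  obtain ⟨ε₀, hε₀, hcount⟩ := exists_ncard_fiber_le θ (law μ α) (law_nonneg μ α) hη
  refine (iInf₂_le _ (lt_min (half_pos hε) hε₀)).trans ?_
  rw [add_assoc, ← EReal.coe_add, law_comp μ hα θ]
  refine finEntropyEps_le_of_ncard_le S (.of_forall fun i =>
    ncard_le_ncard_mul_of_fiber_le (f := fun β => θ ∘ β) (fun β hβ => ?_) fun b _ =>
      le_trans (Nat.cast_le.2 (Set.ncard_le_ncard ?_)) (hcount (S.m i) b))
  · rw [mem_approxPartitions] at hβ ⊢
    have hcomp := l1Dist_law_comp_le μ (uniformMeasure (S.m i)) (hα.orbitName F)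
      (isMeasurablePartition_of_discrete (modelName (S.σ i) F β)) fun φ f => θ (φ f)
    calc _ ≤ _ := l1Dist_triangle _ (law μ (orbitName F (θ ∘ α))) _
      _ ≤ ε / 2 + ε / 2 := add_le_add h (hcomp.trans (hβ.trans (min_le_left _ _)))
      _ = ε := add_halves ε
  · rintro β ⟨hβ, hb⟩
    rw [mem_approxPartitions] at hβ
    exact ⟨hb, (l1Dist_law_le_l1Dist_law_modelName μ (S.σ i) hF hα β).trans
      (hβ.trans (min_le_right _ _))⟩

theorem finEntropyAt_le_finEntropyAt_comp [Finite A] [Finite B] (S : MapSequence G) {α : X → A}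
    (hα : IsMeasurablePartition α) {θ : A → B} (hθ : Function.Injective θ) {F : Finset G}
    (hF : F.Nonempty) : finEntropyAt S μ α F ≤ finEntropyAt S μ (θ ∘ α) F := by
  have := Fintype.ofFinite A
  have := Fintype.ofFinite B
  refine le_iInf₂ fun ε hε => ?_
  have := finEntropyAt_le_of_l1Dist_comp_le μ S hα (α' := θ ∘ α) θ hF hε
    ((l1Dist_self _).le.trans (half_pos hε).le)
  rw [shannonEntropy_law_comp_of_injective hθ] at this
  simpa using this

theorem finEntropyAt_equiv_comp [Finite A] [Finite B] (S : MapSequence G) {α : X → A}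
    (hα : IsMeasurablePartition α) (e : A ≃ B) {F : Finset G} (hF : F.Nonempty) :
    finEntropyAt S μ (e ∘ α) F = finEntropyAt S μ α F := by
  refine le_antisymm ?_ (finEntropyAt_le_finEntropyAt_comp μ S hα e.injective hF)
  have := finEntropyAt_le_finEntropyAt_comp μ S (hα.comp e) e.symm.injective hF
  rwa [← Function.comp_assoc, Equiv.symm_comp_self, Function.id_comp] at this

end Names

/-! ### Sofic approximations at most points -/

section Sofic

variable {G : Type*} [Group G] {m : ℕ}

/-- The points at which `σ` fails to behave like a free action with respect to `D`, in terms of the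
inverse permutations by which `modelName` reads off a word. -/
def badSet (σ : G → Equiv.Perm (Fin m)) (D : Set G) : Set (Fin m) :=
  {v | ∃ d ∈ D, ∃ e ∈ D, (σ e).symm ((σ d).symm v) ≠ (σ (d * e)).symm v ∨
    (d ≠ e ∧ (σ d).symm v = (σ e).symm v)}

theorem symm_symm_eq_of_notMem_badSet {σ : G → Equiv.Perm (Fin m)} {D : Set G} {v : Fin m}
    (hv : v ∉ badSet σ D) {d e : G} (hd : d ∈ D) (he : e ∈ D) :
    (σ e).symm ((σ d).symm v) = (σ (d * e)).symm v := by
  by_contra hne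
  exact hv ⟨d, hd, e, he, .inl hne⟩

theorem injective_of_notMem_badSet {σ : G → Equiv.Perm (Fin m)} {D : Set G} {v : Fin m}
    (hv : v ∉ badSet σ D) : Function.Injective fun f : D => (σ f).symm v := by
  intro f f' h
  by_contra hne
  exact hv ⟨f, f.2, f', f'.2, .inr ⟨fun h' => hne (Subtype.ext h'), h⟩⟩

theorem goodSet_anti (σ : G → Equiv.Perm (Fin m)) {F F' : Set G} (h : F ⊆ F') :
    goodSet σ F' ⊆ goodSet σ F :=
  fun _ hv f₁ h₁ f₂ h₂ => hv f₁ (h h₁) f₂ (h h₂)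

theorem badSet_subset (σ : G → Equiv.Perm (Fin m)) (D : Finset G) :
    badSet σ D ⊆ ⋃ p ∈ D ×ˢ D,
      (σ p.1 '' (goodSet σ D)ᶜ ∪ (σ p.1 * σ p.2 : Equiv.Perm _) '' (goodSet σ D)ᶜ) := by
  rintro v ⟨d, hd, e, he, hv⟩
  refine Set.mem_biUnion (Finset.mk_mem_product hd he) ?_
  rcases hv with hmul | ⟨hne, heq⟩
  · refine .inr ⟨(σ e).symm ((σ d).symm v), fun hgood => hmul ?_, by simp⟩
    have := (hgood d hd e he).1
    rw [Equiv.apply_symm_apply, Equiv.apply_symm_apply] at this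
    exact ((σ (d * e)).symm_apply_eq.2 this).symm
  · refine .inl ⟨(σ d).symm v, fun hgood => (hgood d hd e he).2 hne ?_, by simp⟩
    rw [Equiv.apply_symm_apply, heq, Equiv.apply_symm_apply]

theorem uniformMeasure_badSet_le (σ : G → Equiv.Perm (Fin m)) (D : Finset G) :
    (uniformMeasure m).real (badSet σ D) ≤
      D.card ^ 2 * (2 * (uniformMeasure m).real (goodSet σ D)ᶜ) := by
  have hpair : ∀ p ∈ D ×ˢ D, (uniformMeasure m).real
      (σ p.1 '' (goodSet σ D)ᶜ ∪ (σ p.1 * σ p.2 : Equiv.Perm _) '' (goodSet σ D)ᶜ) ≤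
        2 * (uniformMeasure m).real (goodSet σ D)ᶜ := fun p _ => by
    refine (measureReal_union_le _ _).trans_eq ?_
    rw [uniformMeasure_real_image, uniformMeasure_real_image, two_mul]
  refine (measureReal_mono (badSet_subset _ _) (measure_ne_top _ _)).trans
    ((measureReal_biUnion_finset_le _ _).trans
      ((Finset.sum_le_card_nsmul _ _ _ hpair).trans_eq ?_))
  rw [nsmul_eq_mul, Finset.card_product, Nat.cast_mul, sq]

namespace MapSequence.IsSofic

variable {S : MapSequence G} (hS : S.IsSofic) (D : Finset G) {δ : ℝ} (hδ : 0 < δ)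
include hS hδ

theorem eventually_uniformMeasure_compl_goodSet_le :
    ∀ᶠ i in atTop, (uniformMeasure (S.m i)).real (goodSet (S.σ i) D)ᶜ ≤ δ := by
  obtain ⟨F, ε, hF, hU, hε, happrox⟩ := hS
  have hsub : ∀ᶠ i in atTop, (D : Set G) ⊆ F i := by
    refine ((Finset.eventually_all D).2 fun d _ => ?_).mono fun i hi d hd => hi d hd
    obtain ⟨i, hi⟩ := Set.mem_iUnion.1 (hU ▸ Set.mem_univ d)
    exact eventually_atTop.2 ⟨i, fun j hj => monotone_nat_of_le_succ hF hj hi⟩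
  filter_upwards [hsub, hε.eventually_le_const hδ] with i hi hεi
  have hgood : 1 - ε i ≤ (uniformMeasure (S.m i)).real (goodSet (S.σ i) (F i)) := by
    rw [uniformMeasure_real, le_div_iff₀ (Nat.cast_pos.2 (S.one_le_m i))]
    exact happrox i
  rw [probReal_compl_eq_one_sub MeasurableSet.of_discrete]
  linarith [measureReal_mono (μ := uniformMeasure (S.m i)) (goodSet_anti (S.σ i) hi)]

theorem eventually_uniformMeasure_badSet_le :
    ∀ᶠ i in atTop, (uniformMeasure (S.m i)).real (badSet (S.σ i) D) ≤ δ := by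
  have hη : 0 < δ / (2 * (D.card ^ 2 + 1)) := by positivity
  filter_upwards [hS.eventually_uniformMeasure_compl_goodSet_le D hη] with i hi
  calc _ ≤ _ := uniformMeasure_badSet_le (S.σ i) D
    _ ≤ (D.card ^ 2 + 1) * (2 * (δ / (2 * (D.card ^ 2 + 1)))) := by gcongr; linarith
    _ = δ := by field_simp

end MapSequence.IsSofic

end Sofic

/-! ### Random words -/

section RandomWords

variable {Ω ι : Type*} [MeasurableSpace Ω] {P : Measure Ω} [IsProbabilityMeasure P]

theorem covariance_le_one_of_mem_Icc {X Y : Ω → ℝ} (hX : AEMeasurable X P) (hY : AEMeasurable Y P)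
    (hX01 : ∀ ω, X ω ∈ Set.Icc 0 1) (hY01 : ∀ ω, Y ω ∈ Set.Icc 0 1) : cov[X, Y; P] ≤ 1 := by
  rw [covariance_eq_sub (memLp_of_bounded (.of_forall hX01) hX.aestronglyMeasurable 2)
    (memLp_of_bounded (.of_forall hY01) hY.aestronglyMeasurable 2)]
  have hXY : P[X * Y] ≤ 1 := by
    refine (integral_mono_of_nonneg (.of_forall fun ω => mul_nonneg (hX01 ω).1 (hY01 ω).1)
      (integrable_const (1 : ℝ)) (.of_forall fun ω =>
        mul_le_one₀ (hX01 ω).2 (hY01 ω).1 (hY01 ω).2)).trans_eq ?_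
    simp
  have hX0 : 0 ≤ P[X] := integral_nonneg fun ω => (hX01 ω).1
  have hY0 : 0 ≤ P[Y] := integral_nonneg fun ω => (hY01 ω).1
  linarith [mul_nonneg hX0 hY0]

theorem variance_sum_le_of_indepFun {X : ι → Ω → ℝ} (hX : ∀ i, AEMeasurable (X i) P)
    (hX01 : ∀ i ω, X i ω ∈ Set.Icc 0 1) {N : ι → Finset ι} {d : ℕ} (hN : ∀ i, (N i).card ≤ d)
    (hindep : ∀ i j, j ∉ N i → X i ⟂ᵢ[P] X j) (s : Finset ι) :
    Var[fun ω => ∑ i ∈ s, X i ω; P] ≤ d * s.card := by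
  classical
  have hL2 : ∀ i, MemLp (X i) 2 P := fun i =>
    memLp_of_bounded (.of_forall (hX01 i)) (hX i).aestronglyMeasurable 2
  rw [variance_fun_sum' fun i _ => hL2 i, mul_comm, ← nsmul_eq_mul]
  refine Finset.sum_le_card_nsmul _ _ _ fun i _ => ?_
  calc ∑ j ∈ s, cov[X i, X j; P] ≤ ∑ j ∈ s, if j ∈ N i then (1 : ℝ) else 0 := by
        refine Finset.sum_le_sum fun j _ => ?_
        split_ifs with hj
        · exact covariance_le_one_of_mem_Icc (hX i) (hX j) (hX01 i) (hX01 j)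
        · exact ((hindep i j hj).covariance_eq_zero (hL2 i) (hL2 j)).le
    _ = (s.filter (· ∈ N i)).card := Finset.sum_boole _ _
    _ ≤ d := by
        refine Nat.cast_le.2 ((Finset.card_le_card fun j hj => ?_).trans (hN i))
        exact (Finset.mem_filter.1 hj).2

variable {K B : Type*} [MeasurableSpace K] (κ : Measure K) [IsProbabilityMeasure κ] {c : K → B}
  (hc : IsMeasurablePartition c)
include hc

theorem infinitePi_real_forall_eq {J : Type*} [Fintype J] {u : J → ι} (hu : Function.Injective u)
    (b : J → B) :
    (Measure.infinitePi fun _ : ι => κ).real {ω | ∀ j, c (ω (u j)) = b j} =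
      ∏ j, law κ c (b j) := by
  have hset : {ω : ι → K | ∀ j, c (ω (u j)) = b j} =
      (fun ω j => ω (u j)) ⁻¹' Set.univ.pi fun j => c ⁻¹' {b j} := by
    ext; simp
  rw [hset, ← map_measureReal_apply (by fun_prop) (MeasurableSet.univ_pi fun j => hc _),
    Measure.map_infinitePi_infinitePi_of_inj hu, measureReal_def, Measure.infinitePi_eq_pi,
    Measure.pi_pi, ENNReal.toReal_prod]
  rfl

end RandomWords

section RandomModels

variable {G Y B C : Type*} {m : ℕ}

/-- The indicator of the event that the word `β ∘ ω`, for a random choice `ω` of one point of `Y`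
at every point of the model, has `F`-name `ψ` at `v`. -/
def nameIndicator (β : Y → B) (σ : G → Equiv.Perm (Fin m)) (F : Finset G) (ψ : F → B) (v : Fin m) :
    (Fin m → Y) → ℝ :=
  {ω | modelName σ F (β ∘ ω) v = ψ}.indicator 1

theorem nameIndicator_mem_Icc (β : Y → B) (σ : G → Equiv.Perm (Fin m)) (F : Finset G) (ψ : F → B)
    (v : Fin m) (ω : Fin m → Y) : nameIndicator β σ F ψ v ω ∈ Set.Icc 0 1 :=
  ⟨Set.indicator_nonneg (fun _ _ => zero_le_one) _,
    Set.indicator_le_self' (fun _ _ => zero_le_one) _⟩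

open Classical in
theorem law_modelName_eq_sum_nameIndicator (β : Y → B) (σ : G → Equiv.Perm (Fin m)) (F : Finset G)
    (a : Fin m → C) (φ : C) (ψ : F → B) (ω : Fin m → Y) :
    law (uniformMeasure m) (fun v => (a v, modelName σ F (β ∘ ω) v)) (φ, ψ) =
      (∑ v with a v = φ, nameIndicator β σ F ψ v ω) / m := by
  rw [law_uniformMeasure_eq_sum, Finset.sum_filter]
  congr 1
  refine Finset.sum_congr rfl fun v _ => ?_
  simp only [Prod.mk.injEq, nameIndicator, Set.indicator_apply, Set.mem_ofPred_eq, ite_and,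
    Pi.one_apply]

variable [MeasurableSpace Y] {β : Y → B} (hβ : IsMeasurablePartition β)
  (σ : G → Equiv.Perm (Fin m)) (F : Finset G) (ψ : F → B)
include hβ

theorem measurableSet_modelName_eq (v : Fin m) :
    MeasurableSet {ω : Fin m → Y | modelName σ F (β ∘ ω) v = ψ} := by
  simp only [modelName, funext_iff, Set.ofPred_forall]
  exact MeasurableSet.iInter fun f =>
    (measurable_pi_apply (X := fun _ => Y) ((σ f).symm v)) (hβ (ψ f))

theorem measurable_nameIndicator (v : Fin m) : Measurable (nameIndicator β σ F ψ v) :=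
  measurable_one.indicator (measurableSet_modelName_eq hβ σ F ψ v)

variable (ν : Measure Y) [IsProbabilityMeasure ν]

theorem integral_nameIndicator [Group G] {v : Fin m} (hv : v ∉ badSet σ F) :
    ∫ ω, nameIndicator β σ F ψ v ω ∂(Measure.infinitePi fun _ => ν) = ∏ f, law ν β (ψ f) := by
  rw [nameIndicator, integral_indicator_one (measurableSet_modelName_eq hβ σ F ψ v)]
  simpa [modelName, funext_iff] using
    infinitePi_real_forall_eq ν hβ (injective_of_notMem_badSet hv) ψ

open Classical in
theorem indepFun_nameIndicator {v w : Fin m}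
    (h : Disjoint (Finset.univ.image fun f : F => (σ f).symm v)
      (Finset.univ.image fun f : F => (σ f).symm w)) :
    nameIndicator β σ F ψ v ⟂ᵢ[Measure.infinitePi fun _ => ν] nameIndicator β σ F ψ w := by
  have hcoord : iIndepFun (fun (v : Fin m) (ω : Fin m → Y) => ω v)
      (Measure.infinitePi fun _ : Fin m => ν) :=
    iIndepFun_infinitePi (X := fun _ : Fin m => (id : Y → Y)) fun _ => measurable_id
  let name (v : Fin m) (y : (Finset.univ.image fun f : F => (σ f).symm v) → Y) (f : F) : B :=
    β (y ⟨(σ f).symm v, Finset.mem_image_of_mem _ (Finset.mem_univ f)⟩)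
  have hname (v : Fin m) : Measurable ({y | name v y = ψ}.indicator (fun _ => (1 : ℝ))) := by
    refine measurable_const.indicator ?_
    simp only [name, funext_iff, Set.ofPred_forall]
    exact MeasurableSet.iInter fun f => (measurable_pi_apply (X := fun _ => Y) _) (hβ (ψ f))
  exact (hcoord.indepFun_finset _ _ h fun v => measurable_pi_apply v).comp (hname v) (hname w)

theorem variance_sum_nameIndicator_le (s : Finset (Fin m)) :
    Var[fun ω => ∑ v ∈ s, nameIndicator β σ F ψ v ω; Measure.infinitePi fun _ => ν] ≤
      (F.card ^ 2 : ℕ) * s.card := by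
  let N (v : Fin m) : Finset (Fin m) := (F ×ˢ F).image fun p => σ p.2 ((σ p.1).symm v)
  refine variance_sum_le_of_indepFun (N := N)
    (fun v => (measurable_nameIndicator hβ σ F ψ v).aemeasurable)
    (nameIndicator_mem_Icc β σ F ψ) (fun v => Finset.card_image_le.trans_eq ?_)
    (fun v w hw => ?_) s
  · rw [Finset.card_product, sq]
  · refine indepFun_nameIndicator hβ σ F ψ ν (Finset.disjoint_left.2 fun x hxv hxw => hw ?_)
    simp only [Finset.mem_image, Finset.mem_univ, true_and] at hxv hxw
    obtain ⟨f, rfl⟩ := hxv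
    obtain ⟨f', hf'⟩ := hxw
    exact Finset.mem_image.2 ⟨(f, f'), Finset.mk_mem_product f.2 f'.2, by simp [← hf']⟩

open Classical in
theorem abs_integral_nameIndicator_sub_le [Group G] (v : Fin m) :
    |∫ ω, nameIndicator β σ F ψ v ω ∂(Measure.infinitePi fun _ => ν) - ∏ f, law ν β (ψ f)| ≤
      if v ∈ badSet σ F then 1 else 0 := by
  split_ifs with hv
  · have hX0 : 0 ≤ ∫ ω, nameIndicator β σ F ψ v ω ∂(Measure.infinitePi fun _ => ν) :=
      integral_nonneg fun ω => (nameIndicator_mem_Icc β σ F ψ v ω).1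
    have hX1 : ∫ ω, nameIndicator β σ F ψ v ω ∂(Measure.infinitePi fun _ => ν) ≤ 1 := by
      rw [nameIndicator, integral_indicator_one (measurableSet_modelName_eq hβ σ F ψ v)]
      exact measureReal_le_one
    have hq0 : 0 ≤ ∏ f, law ν β (ψ f) := Finset.prod_nonneg fun _ _ => law_nonneg _ _ _
    have hq1 : ∏ f, law ν β (ψ f) ≤ 1 :=
      Finset.prod_le_one (fun _ _ => law_nonneg _ _ _) fun _ _ => measureReal_le_one
    rw [abs_le]
    constructor <;> linarith
  · rw [integral_nameIndicator hβ σ F ψ ν hv, sub_self, abs_zero]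

theorem abs_integral_law_modelName_sub_le [Group G] (a : Fin m → C) (φ : C) :
    |∫ ω, law (uniformMeasure m) (fun v => (a v, modelName σ F (β ∘ ω) v)) (φ, ψ)
        ∂(Measure.infinitePi fun _ => ν) -
      law (uniformMeasure m) a φ * ∏ f, law ν β (ψ f)| ≤
        (uniformMeasure m).real (badSet σ F) := by
  classical
  have hint (v : Fin m) : Integrable (nameIndicator β σ F ψ v) (Measure.infinitePi fun _ => ν) :=
    (memLp_of_bounded (.of_forall (nameIndicator_mem_Icc β σ F ψ v))
      (measurable_nameIndicator hβ σ F ψ v).aestronglyMeasurable 1).integrable le_rfl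
  have hbad : (uniformMeasure m).real (badSet σ F) =
      (∑ v, if v ∈ badSet σ F then (1 : ℝ) else 0) / m := by
    simpa [law] using law_uniformMeasure_eq_sum (· ∈ badSet σ F) True
  simp only [law_modelName_eq_sum_nameIndicator]
  rw [integral_div, integral_finsetSum _ fun v _ => hint v, law_uniformMeasure_eq_sum,
    ← Finset.sum_filter, div_mul_eq_mul_div, Finset.sum_mul, ← sub_div, ← Finset.sum_sub_distrib,
    abs_div, Nat.abs_cast, hbad]
  gcongr
  refine (Finset.abs_sum_le_sum_abs _ _).trans ((Finset.sum_le_sum fun v _ => ?_).trans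
    (Finset.sum_le_sum_of_subset_of_nonneg (Finset.subset_univ _) fun v _ _ => ?_))
  · simpa only [one_mul] using abs_integral_nameIndicator_sub_le hβ σ F ψ ν v
  · split_ifs <;> simp

theorem variance_law_modelName_le [NeZero m] (a : Fin m → C) (φ : C) :
    Var[fun ω => law (uniformMeasure m) (fun v => (a v, modelName σ F (β ∘ ω) v)) (φ, ψ);
        Measure.infinitePi fun _ => ν] ≤ F.card ^ 2 / m := by
  classical
  have hm : (0 : ℝ) < m := Nat.cast_pos.2 (NeZero.pos m)
  have hcard : ((Finset.univ.filter fun v => a v = φ).card : ℝ) ≤ m := by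
    exact_mod_cast (Finset.card_le_univ _).trans_eq (Fintype.card_fin m)
  simp only [law_modelName_eq_sum_nameIndicator, div_eq_inv_mul]
  rw [variance_const_mul]
  calc _ ≤ (m : ℝ)⁻¹ ^ 2 * ((F.card ^ 2 : ℕ) * m) := by
        gcongr
        exact (variance_sum_nameIndicator_le hβ σ F ψ ν _).trans (by gcongr)
    _ = (m : ℝ)⁻¹ * F.card ^ 2 := by push_cast; field_simp

theorem measureReal_two_mul_le_abs_law_modelName_sub_le [Group G] [NeZero m] (a : Fin m → C)
    (φ : C) {t : ℝ} (ht : 0 < t) (hbad : (uniformMeasure m).real (badSet σ F) ≤ t) :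
    (Measure.infinitePi fun _ : Fin m => ν).real
        {ω | 2 * t ≤ |law (uniformMeasure m) a φ * ∏ f, law ν β (ψ f) -
          law (uniformMeasure m) (fun v => (a v, modelName σ F (β ∘ ω) v)) (φ, ψ)|} ≤
      F.card ^ 2 / m / t ^ 2 := by
  classical
  set P := Measure.infinitePi fun _ : Fin m => ν
  set R : (Fin m → Y) → ℝ :=
    fun ω => law (uniformMeasure m) (fun v => (a v, modelName σ F (β ∘ ω) v)) (φ, ψ)
  have hR : MemLp R 2 P := by
    have hmeas : Measurable R := by
      simp only [R, law_modelName_eq_sum_nameIndicator]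
      exact (Finset.measurable_fun_sum _ fun v _ =>
        measurable_nameIndicator hβ σ F ψ v).div_const _
    exact memLp_of_bounded (.of_forall fun ω => ⟨measureReal_nonneg, measureReal_le_one⟩)
      hmeas.aestronglyMeasurable 2
  have hmean : |P[R] - _| ≤ t := (abs_integral_law_modelName_sub_le hβ σ F ψ ν a φ).trans hbad
  have hsub : {ω | 2 * t ≤ |law (uniformMeasure m) a φ * ∏ f, law ν β (ψ f) - R ω|} ⊆
      {ω | t ≤ |R ω - P[R]|} := by
    intro ω (hω : 2 * t ≤ _)
    rw [abs_sub_comm] at hω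
    have := abs_sub_le (R ω) P[R] (law (uniformMeasure m) a φ * ∏ f, law ν β (ψ f))
    exact show t ≤ _ by linarith
  calc _ ≤ P.real {ω | t ≤ |R ω - P[R]|} := measureReal_mono hsub
    _ ≤ (ENNReal.ofReal (Var[R; P] / t ^ 2)).toReal :=
      ENNReal.toReal_mono ENNReal.ofReal_ne_top (meas_ge_le_variance_div_sq hR ht)
    _ = Var[R; P] / t ^ 2 :=
      ENNReal.toReal_ofReal (div_nonneg (variance_nonneg _ _) (sq_nonneg t))
    _ ≤ _ := by gcongr; exact variance_law_modelName_le hβ σ F ψ ν a φ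

end RandomModels

section IndependentProduct

variable {G X Y A B C : Type*} [Group G] [MeasurableSpace X] [MeasurableSpace Y]

theorem exists_le_abs_sub_of_lt_l1Dist [Fintype C] {p q : C → ℝ} {t : ℝ}
    (h : Fintype.card C * t < l1Dist p q) : ∃ x, t ≤ |p x - q x| := by
  by_contra! hlt
  rw [l1Dist_eq_sum] at h
  refine h.not_ge ((Finset.sum_le_card_nsmul _ _ t fun x _ => (hlt x).le).trans_eq ?_)
  rw [nsmul_eq_mul, Finset.card_univ]

theorem l1Dist_mul_right [Finite A] [Fintype B] (p p' : A → ℝ) {q : B → ℝ} (hq : ∀ b, 0 ≤ q b)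
    (hq1 : ∑ b, q b = 1) :
    l1Dist (fun x : A × B => p x.1 * q x.2) (fun x => p' x.1 * q x.2) = l1Dist p p' := by
  have := Fintype.ofFinite A
  simp only [l1Dist_eq_sum, Fintype.sum_prod_type, ← sub_mul, abs_mul, abs_of_nonneg (hq _),
    ← Finset.mul_sum, hq1, mul_one]

theorem MapSequence.IsSofic.eventually_measureReal_lt_l1Dist_le {S : MapSequence G} (hS : S.IsSofic)
    [Finite B] [Finite C] (ν : Measure Y) [IsProbabilityMeasure ν] {β : Y → B}
    (hβ : IsMeasurablePartition β) (F : Finset G) {δ : ℝ} (hδ : 0 < δ) :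
    ∀ᶠ i in atTop, ∀ a : Fin (S.m i) → C,
      (Measure.infinitePi fun _ : Fin (S.m i) => ν).real
        {ω | δ < l1Dist
          (fun x : C × (F → B) => law (uniformMeasure (S.m i)) a x.1 * ∏ f, law ν β (x.2 f))
          (law (uniformMeasure (S.m i)) fun v => (a v, modelName (S.σ i) F (β ∘ ω) v))} ≤
        1 / 2 := by
  have := Fintype.ofFinite (C × (F → B))
  set n := (Fintype.card (C × (F → B)) : ℝ)
  obtain ⟨t, ht, htn⟩ : ∃ t > 0, n * (2 * t) ≤ δ := by
    refine ⟨δ / (2 * (n + 1)), by positivity, ?_⟩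
    calc n * (2 * (δ / (2 * (n + 1)))) ≤ (n + 1) * (2 * (δ / (2 * (n + 1)))) := by
          gcongr; linarith
      _ = δ := by
        have : n + 1 ≠ 0 := by positivity
        field_simp
  have hcheb : ∀ᶠ i in atTop, n * (F.card ^ 2 / S.m i / t ^ 2) ≤ 1 / 2 := by
    have hm : Tendsto (fun i => (S.m i : ℝ)) atTop atTop :=
      tendsto_natCast_atTop_atTop.comp S.tendsto_m
    have hlim := ((hm.const_div_atTop ((F.card : ℝ) ^ 2)).div_const (t ^ 2)).const_mul n
    rw [zero_div, mul_zero] at hlim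
    exact hlim.eventually_le_const one_half_pos
  filter_upwards [hS.eventually_uniformMeasure_badSet_le F ht, hcheb] with i hbad hi a
  refine (measureReal_mono fun ω hω => ?_).trans
    ((measureReal_iUnion_fintype_le fun x : C × (F → B) => _).trans ((Finset.sum_le_card_nsmul
      _ _ _ fun x _ => measureReal_two_mul_le_abs_law_modelName_sub_le hβ (S.σ i) F x.2 ν a x.1
        ht hbad).trans ?_))
  · exact Set.mem_iUnion.2 (exists_le_abs_sub_of_lt_l1Dist (htn.trans_lt hω))
  · rwa [nsmul_eq_mul, Finset.card_univ]

theorem measureReal_comp_mem_le [Finite B] (ν : Measure Y) [IsProbabilityMeasure ν] {β : Y → B}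
    (hβ : IsMeasurablePartition β) {m : ℕ} {T : Set (Fin m → B)} {c : ℝ}
    (hc : ∀ b ∈ T, ∏ v, law ν β (b v) ≤ c) :
    (Measure.infinitePi fun _ : Fin m => ν).real {ω | β ∘ ω ∈ T} ≤ T.ncard * c := by
  have hword (b : Fin m → B) : (Measure.infinitePi fun _ : Fin m => ν).real {ω | β ∘ ω = b} =
      ∏ v, law ν β (b v) := by
    simpa [funext_iff] using infinitePi_real_forall_eq ν hβ Function.injective_id b
  have hunion : {ω : Fin m → Y | β ∘ ω ∈ T} = ⋃ b ∈ T.toFinite.toFinset, {ω | β ∘ ω = b} := by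
    ext; simp
  rw [hunion, Set.ncard_eq_toFinset_card T, ← nsmul_eq_mul]
  refine (measureReal_biUnion_finset_le _ _).trans
    (Finset.sum_le_card_nsmul _ _ _ fun b hb => (hword b).trans_le (hc b ?_))
  simpa using hb

theorem half_le_ncard_mul [Finite B] (ν : Measure Y) [IsProbabilityMeasure ν] {β : Y → B}
    (hβ : IsMeasurablePartition β) {m : ℕ} {T : Set (Fin m → B)} {c : ℝ}
    (hc : ∀ b ∈ T, ∏ v, law ν β (b v) ≤ c)
    (hT : (Measure.infinitePi fun _ : Fin m => ν).real {ω | β ∘ ω ∈ T}ᶜ ≤ 1 / 2) :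
    1 / 2 ≤ T.ncard * c := by
  have hunion := measureReal_union_le (μ := Measure.infinitePi fun _ : Fin m => ν)
    {ω | β ∘ ω ∈ T} {ω | β ∘ ω ∈ T}ᶜ
  rw [Set.union_compl_self, probReal_univ] at hunion
  linarith [measureReal_comp_mem_le ν hβ hc]

theorem exp_le_of_half_le_mul_exp_neg {n x y : ℝ} (h : 1 / 2 ≤ n * Real.exp (-x))
    (hxy : Real.log 2 + y ≤ x) : Real.exp y ≤ n := by
  rw [Real.exp_neg, ← div_eq_mul_inv, le_div_iff₀ (Real.exp_pos _)] at h
  have := Real.exp_le_exp.2 hxy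
  rw [Real.exp_add, Real.exp_log two_pos] at this
  linarith

theorem prodPartition_preimage {X Y : Type*} (α : X → A) (β : Y → B) (x : A × B) :
    prodPartition α β ⁻¹' {x} = (α ⁻¹' {x.1}) ×ˢ (β ⁻¹' {x.2}) := by
  ext; simp [prodPartition, Prod.ext_iff]

theorem IsMeasurablePartition.prodPartition {α : X → A} {β : Y → B}
    (hα : IsMeasurablePartition α) (hβ : IsMeasurablePartition β) :
    IsMeasurablePartition (prodPartition α β) := fun x => by
  rw [prodPartition_preimage]
  exact (hα x.1).prod (hβ x.2)

theorem law_prodPartition (μ : Measure X) (ν : Measure Y) [SFinite ν] (α : X → A) (β : Y → B) :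
    law (μ.prod ν) (prodPartition α β) = fun x => law μ α x.1 * law ν β x.2 :=
  funext fun x => by rw [law, prodPartition_preimage, measureReal_prod_prod]; rfl

theorem law_comp_fst (μ : Measure X) (ν : Measure Y) [IsProbabilityMeasure ν] (α : X → A) :
    law (μ.prod ν) (α ∘ Prod.fst) = law μ α := funext fun a => by
  rw [law, Set.preimage_comp, ← Set.prod_univ, measureReal_prod_prod, probReal_univ, mul_one]
  rfl

theorem law_comp_snd (μ : Measure X) [IsProbabilityMeasure μ] (ν : Measure Y) [SFinite ν]
    (β : Y → B) : law (μ.prod ν) (β ∘ Prod.snd) = law ν β := funext fun b => by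
  rw [law, Set.preimage_comp, ← Set.univ_prod, measureReal_prod_prod, probReal_univ, one_mul]
  rfl

variable [MulAction G X] [MeasurableConstSMul G X] [MulAction G Y] [MeasurableConstSMul G Y]

instance : MeasurableConstSMul G (X × Y) where
  measurable_const_smul g := (measurable_fst.const_smul g).prodMk (measurable_snd.const_smul g)

variable (μ : Measure X) [IsProbabilityMeasure μ] (ν : Measure Y) [IsProbabilityMeasure ν]

theorem l1Dist_law_orbitName_prodPartition_le [Finite A] [Finite B] {α : X → A} {β : Y → B}
    (hα : IsMeasurablePartition α) (hβ : IsMeasurablePartition β) {m : ℕ}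
    (σ : G → Equiv.Perm (Fin m)) (F : Finset G) (a : Fin m → A) (b : Fin m → B) :
    l1Dist (law (μ.prod ν) (orbitName F (prodPartition α β)))
        (law (uniformMeasure m) (modelName σ F fun v => (a v, b v))) ≤
      l1Dist (fun x : (F → A) × (F → B) => law μ (orbitName F α) x.1 * law ν (orbitName F β) x.2)
        (law (uniformMeasure m) fun v => (modelName σ F a v, modelName σ F b v)) := by
  rw [← law_prodPartition]
  let pair (x : (F → A) × (F → B)) (f : F) : A × B := (x.1 f, x.2 f)
  exact l1Dist_law_comp_le (μ.prod ν) (uniformMeasure m)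
    ((hα.orbitName F).prodPartition (hβ.orbitName F))
    (isMeasurablePartition_of_discrete fun v => (modelName σ F a v, modelName σ F b v)) pair

variable [SMulInvariantMeasure G X μ] [SMulInvariantMeasure G Y ν]

instance : SMulInvariantMeasure G (X × Y) (μ.prod ν) where
  measure_preimage_smul g _ hs :=
    ((measurePreserving_smul g μ).prod (measurePreserving_smul g ν)).measure_preimage
      hs.nullMeasurableSet

variable [Fintype B] {S : MapSequence G} (hS : S.IsSofic) {α : X → A} {β : Y → B}
  (hα : IsMeasurablePartition α) (hβ : IsMeasurablePartition β) {F : Finset G} (hF : F.Nonempty)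
  (hindep : ∀ ψ, law ν (orbitName F β) ψ = ∏ f, law ν β (ψ f))
include hS hα hβ hF hindep

-- Most choices of a random second coordinate extend an approximating partition of the first factor.
theorem exists_eventually_exp_le_ncard_lifts [Finite A] {ε η : ℝ} (hε : 0 < ε) (hη : 0 < η) :
    ∃ δ > 0, ∀ᶠ i in atTop, ∀ a ∈ approxPartitions μ (S.σ i) F α δ,
      Real.exp (S.m i * (shannonEntropy (law ν β) - η)) ≤
        ({c ∈ approxPartitions (μ.prod ν) (S.σ i) F (prodPartition α β) ε |
          Prod.fst ∘ c = a}.ncard : ℝ) := by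
  classical
  have := Fintype.ofFinite A
  obtain ⟨ε₀, hε₀, hprod⟩ := exists_forall_l1Dist_le_prod_le (law ν β) (law_nonneg ν β)
    (half_pos hη)
  obtain ⟨δ, hδ, hδε⟩ : ∃ δ > 0, δ + δ ≤ min ε ε₀ :=
    ⟨min ε ε₀ / 2, half_pos (lt_min hε hε₀), (add_halves _).le⟩
  have hm : ∀ᶠ i in atTop, Real.log 2 ≤ S.m i * (η / 2) :=
    ((tendsto_natCast_atTop_atTop.comp S.tendsto_m).atTop_mul_const
      (half_pos hη)).eventually_ge_atTop _
  refine ⟨δ, hδ, ?_⟩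
  filter_upwards [hS.eventually_measureReal_lt_l1Dist_le (C := F → A) ν hβ F hδ, hm]
    with i hrandom hi a ha
  simp only [← hindep] at hrandom
  set T : Set (Fin (S.m i) → B) := {b | l1Dist (fun x : (F → A) × (F → B) =>
    law (uniformMeasure (S.m i)) (modelName (S.σ i) F a) x.1 * law ν (orbitName F β) x.2)
    (law (uniformMeasure (S.m i)) fun v => (modelName (S.σ i) F a v, modelName (S.σ i) F b v)) ≤ δ}
  have hmem : ∀ b ∈ T, l1Dist (law (μ.prod ν) (orbitName F (prodPartition α β)))
      (law (uniformMeasure (S.m i)) (modelName (S.σ i) F fun v => (a v, b v))) ≤ min ε ε₀ := by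
    refine fun b hb => (l1Dist_law_orbitName_prodPartition_le μ ν hα hβ (S.σ i) F a b).trans
      ((l1Dist_triangle _ _ _).trans ((add_le_add ?_ hb).trans hδε))
    rw [l1Dist_mul_right _ _ (law_nonneg ν _) (sum_law ν (hβ.orbitName F))]
    exact mem_approxPartitions.1 ha
  have hle : ∀ b ∈ T, ∏ v, law ν β (b v) ≤
      Real.exp (-(S.m i * (shannonEntropy (law ν β) - η / 2))) := fun b hb => by
    refine hprod (S.m i) b (le_trans ?_ ((hmem b hb).trans (min_le_right _ _)))
    refine le_trans ?_ (l1Dist_law_le_l1Dist_law_modelName (μ.prod ν) (S.σ i) hF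
      (hα.prodPartition hβ) fun v => (a v, b v))
    rw [← law_comp_snd μ ν β]
    exact l1Dist_law_comp_le (μ.prod ν) (uniformMeasure (S.m i)) (hα.prodPartition hβ)
      (isMeasurablePartition_of_discrete fun v => (a v, b v)) Prod.snd
  have hT := half_le_ncard_mul ν hβ hle <| by
    simpa only [T, Set.compl_ofPred, Set.mem_ofPred_eq, not_le] using
      hrandom (modelName (S.σ i) F a)
  calc Real.exp (S.m i * (shannonEntropy (law ν β) - η)) ≤ T.ncard :=
        exp_le_of_half_le_mul_exp_neg hT (by linarith)
    _ ≤ _ := by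
      refine Nat.cast_le.2 (Set.ncard_le_ncard_of_injOn (fun b v => (a v, b v)) (fun b hb =>
        ⟨mem_approxPartitions.2 ((hmem b hb).trans (min_le_left _ _)), rfl⟩) ?_)
      exact fun b _ b' _ h => funext fun v => (Prod.ext_iff.1 (congrFun h v)).2

theorem finEntropyAt_add_le [Finite A] :
    finEntropyAt S μ α F + (shannonEntropy (law ν β) : EReal) ≤
      finEntropyAt S (μ.prod ν) (prodPartition α β) F := by
  refine le_iInf₂ fun ε hε => ?_
  suffices h : finEntropyAt S μ α F ≤ finEntropyEps S (μ.prod ν) (prodPartition α β) F ε +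
      ((-shannonEntropy (law ν β) : ℝ) : EReal) by
    have h' := add_le_add_left h (shannonEntropy (law ν β) : EReal)
    rwa [add_assoc, ← EReal.coe_add, neg_add_cancel, EReal.coe_zero, add_zero] at h'
  refine le_of_forall_pos_le_add_coe fun η hη => ?_
  obtain ⟨δ, hδ, hlifts⟩ := exists_eventually_exp_le_ncard_lifts μ ν hS hα hβ hF hindep hε hη
  refine (iInf₂_le δ hδ).trans ?_
  rw [add_assoc, ← EReal.coe_add]
  refine finEntropyEps_le_of_ncard_le S (hlifts.mono fun i hi => ?_)
  have hneg : S.m i * (-shannonEntropy (law ν β) + η) =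
      -(S.m i * (shannonEntropy (law ν β) - η)) := by ring
  rw [hneg, Real.exp_neg, ← div_eq_mul_inv, le_div_iff₀ (Real.exp_pos _)]
  exact ncard_mul_le_ncard_of_le_fiber hi

theorem finEntropyAt_prodPartition [Finite A] :
    finEntropyAt S (μ.prod ν) (prodPartition α β) F =
      finEntropyAt S μ α F + (shannonEntropy (law ν β) : EReal) := by
  have := Fintype.ofFinite A
  refine le_antisymm ?_ (finEntropyAt_add_le μ ν hS hα hβ hF hindep)
  have hfst : Prod.fst ∘ prodPartition α β = α ∘ Prod.fst := rfl
  have horbit : orbitName F (α ∘ Prod.fst) = orbitName F α ∘ (Prod.fst : X × Y → X) := rfl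
  rw [← finEntropyAt_congr S (μ := μ.prod ν) (α := α ∘ Prod.fst)
    (by rw [horbit, law_comp_fst])]
  have hH : shannonEntropy (law (μ.prod ν) (prodPartition α β)) -
      shannonEntropy (law (μ.prod ν) (Prod.fst ∘ prodPartition α β)) =
        shannonEntropy (law ν β) := by
    rw [hfst, law_comp_fst, law_prodPartition,
      shannonEntropy_mul (sum_law μ hα) (sum_law ν hβ), add_sub_cancel_left]
  have hle (ε : {ε : ℝ // 0 < ε}) : finEntropyAt S (μ.prod ν) (prodPartition α β) F ≤
      finEntropyEps S (μ.prod ν) (α ∘ Prod.fst) F ε + (shannonEntropy (law ν β) : EReal) := by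
    rw [← hH]
    refine finEntropyAt_le_of_l1Dist_comp_le (μ.prod ν) S (hα.prodPartition hβ) Prod.fst hF ε.2 ?_
    rw [hfst, l1Dist_self]
    exact (half_pos ε.2).le
  refine (le_iInf_add_coe hle).trans_eq ?_
  rw [iInf_subtype]
  rfl

end IndependentProduct

/-! ### Countable partitions and their finite coarsenings -/

section Coarsening

variable {X ι A : Type*} [MeasurableSpace X]

theorem negMulLog_law_nonneg (μ : Measure X) [IsProbabilityMeasure μ] (α : X → ι) (t : ι) :
    0 ≤ Real.negMulLog (law μ α t) :=
  Real.negMulLog_nonneg (law_nonneg _ _ _) measureReal_le_one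

theorem toReal_partitionEntropy (μ : Measure X) [IsProbabilityMeasure μ] (α : X → ι) :
    (partitionEntropy μ α).toReal = ∑' t, Real.negMulLog (law μ α t) := by
  rw [partitionEntropy, ENNReal.tsum_toReal_eq fun _ => ENNReal.ofReal_ne_top]
  exact tsum_congr fun t => ENNReal.toReal_ofReal (negMulLog_law_nonneg μ α t)

theorem coe_shannonEntropy_law [Fintype A] (μ : Measure X) [IsProbabilityMeasure μ] (α : X → A) :
    (shannonEntropy (law μ α) : EReal) = (partitionEntropy μ α : EReal) := by
  have hH : partitionEntropy μ α ≠ ⊤ := by simp [partitionEntropy]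
  rw [← EReal.coe_ennreal_toReal hH, toReal_partitionEntropy, tsum_fintype, shannonEntropy]

theorem hasSum_negMulLog_law (μ : Measure X) [IsProbabilityMeasure μ] {α : X → ι}
    (hH : partitionEntropy μ α < ⊤) :
    HasSum (fun t => Real.negMulLog (law μ α t)) (partitionEntropy μ α).toReal := by
  rw [toReal_partitionEntropy]
  have := ENNReal.summable_toReal (f := fun t => ENNReal.ofReal (Real.negMulLog (law μ α t))) hH.ne
  simpa only [ENNReal.toReal_ofReal (negMulLog_law_nonneg μ α _)] using this.hasSum

theorem law_mul_neg_log_law_comp_le (μ : Measure X) [IsFiniteMeasure μ] (α : X → ι)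
    (j : ι → A) (t : ι) :
    law μ α t * -Real.log (law μ (j ∘ α) (j t)) ≤ Real.negMulLog (law μ α t) := by
  rw [Real.negMulLog, neg_mul, ← mul_neg]
  rcases (law_nonneg μ α t).eq_or_lt with h | h
  · simp [← h]
  · have law_le : law μ α t ≤ law μ (j ∘ α) (j t) :=
      measureReal_mono (by rintro x rfl; rfl)
    exact mul_le_mul_of_nonneg_left (neg_le_neg (Real.log_le_log h law_le)) h.le

variable [Countable ι] (μ : Measure X) [IsProbabilityMeasure μ] {α : X → ι}
  (hα : IsMeasurablePartition α)
include hα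

theorem hasSum_indicator_law (T : Set ι) : HasSum (T.indicator (law μ α)) (μ.real (α ⁻¹' T)) := by
  have hsum := tsum_measure_preimage_singleton (μ := μ) T.to_countable fun t _ => hα t
  have := ENNReal.hasSum_toReal (hsum ▸ measure_ne_top μ (α ⁻¹' T))
  rw [← ENNReal.tsum_toReal_eq fun _ => measure_ne_top μ _, hsum] at this
  exact hasSum_subtype_iff_indicator.1 this

theorem hasSum_law : HasSum (law μ α) 1 := by
  simpa using hasSum_indicator_law μ hα Set.univ

theorem exists_finset_lt_sum_law {δ : ℝ} (hδ : 0 < δ) :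
    ∃ T : Finset ι, (∀ t ∈ T, law μ α t ≠ 0) ∧ 1 - δ < ∑ t ∈ T, law μ α t := by
  classical
  obtain ⟨T, hT⟩ := ((hasSum_law μ hα).eventually_const_lt (sub_lt_self 1 hδ)).exists
  exact ⟨T.filter fun t => law μ α t ≠ 0, fun t ht => (Finset.mem_filter.1 ht).2,
    by rwa [Finset.sum_filter_ne_zero]⟩

variable [Fintype A]

theorem hasSum_shannonEntropy_comp (j : ι → A) :
    HasSum (fun t => law μ α t * -Real.log (law μ (j ∘ α) (j t)))
      (shannonEntropy (law μ (j ∘ α))) := by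
  have hfiber (s : A) : HasSum
      (fun t => (j ⁻¹' {s}).indicator (law μ α) t * -Real.log (law μ (j ∘ α) s))
      (law μ (j ∘ α) s * -Real.log (law μ (j ∘ α) s)) :=
    (hasSum_indicator_law μ hα (j ⁻¹' {s})).mul_right _
  convert hasSum_sum (s := Finset.univ) fun s _ => hfiber s using 1
  · ext t
    rw [Finset.sum_eq_single (j t)]
    · simp
    · intro s _ hs
      simp [hs.symm]
    · simp
  · simp [shannonEntropy, Real.negMulLog]

theorem shannonEntropy_comp_le (hH : partitionEntropy μ α < ⊤) (j : ι → A) :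
    shannonEntropy (law μ (j ∘ α)) ≤ (partitionEntropy μ α).toReal :=
  hasSum_le (law_mul_neg_log_law_comp_le μ α j) (hasSum_shannonEntropy_comp μ hα j)
    (hasSum_negMulLog_law μ hH)

end Coarsening

section Separating

variable {X ι : Type*} [MeasurableSpace X] {B : ℕ → Type*}

/-- A sequence of coarsenings which eventually distinguishes any two atoms of positive measure.
Along such a sequence of finite coarsenings the law and the entropy of `α` are recovered in the
limit. -/
def IsSeparating (μ : Measure X) (α : X → ι) (j : ∀ n, ι → B n) : Prop :=
  ∀ t t', t ≠ t' → law μ α t ≠ 0 → law μ α t' ≠ 0 → ∀ᶠ n in atTop, j n t ≠ j n t'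

namespace IsSeparating

theorem eventually_injOn {μ : Measure X} {α : X → ι} {j : ∀ n, ι → B n}
    (hj : IsSeparating μ α j) {T : Finset ι} (hT : ∀ t ∈ T, law μ α t ≠ 0) :
    ∀ᶠ n in atTop, Set.InjOn (j n) T := by
  simp only [Set.InjOn, SetLike.mem_coe]
  refine (Finset.eventually_all T).2 fun t ht => (Finset.eventually_all T).2 fun t' ht' => ?_
  by_cases h : t = t'
  · exact .of_forall fun _ _ => h
  · filter_upwards [hj t t' h (hT t ht) (hT t' ht')] with n hn heq
    exact absurd heq hn

variable [Countable ι] {μ : Measure X} [IsProbabilityMeasure μ] {α : X → ι}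
  (hα : IsMeasurablePartition α) {j : ∀ n, ι → B n} (hj : IsSeparating μ α j)
include hα hj

theorem tendsto_law {t : ι} (ht : law μ α t ≠ 0) :
    Tendsto (fun n => law μ (j n ∘ α) (j n t)) atTop (𝓝 (law μ α t)) := by
  have law_comp_eq (n : ℕ) : law μ (j n ∘ α) (j n t) =
      ∑' t', (j n ⁻¹' {j n t}).indicator (law μ α) t' :=
    (hasSum_indicator_law μ hα (j n ⁻¹' {j n t})).tsum_eq.symm
  have law_eq : law μ α t = ∑' t', Set.indicator {t} (law μ α) t' :=
    (hasSum_indicator_law μ hα {t}).tsum_eq.symm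
  rw [law_eq]
  simp only [law_comp_eq]
  refine tendsto_tsum_of_dominated_convergence (hasSum_law μ hα).summable (fun t' => ?_)
    (.of_forall fun n t' => (norm_indicator_le_norm_self _ _).trans_eq
      (Real.norm_of_nonneg (law_nonneg μ α t')))
  rcases eq_or_ne t' t with rfl | htt
  · simp
  · rcases eq_or_ne (law μ α t') 0 with h0 | h0
    · have indicator_eq_zero (s : Set ι) : s.indicator (law μ α) t' = 0 :=
        Set.indicator_apply_eq_zero.2 fun _ => h0
      simp [indicator_eq_zero]
    · refine tendsto_const_nhds.congr' ?_
      filter_upwards [hj t' t htt h0 ht] with n hn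
      simp [htt, hn]

theorem tendsto_shannonEntropy [∀ n, Fintype (B n)] (hH : partitionEntropy μ α < ⊤) :
    Tendsto (fun n => shannonEntropy (law μ (j n ∘ α))) atTop
      (𝓝 (partitionEntropy μ α).toReal) := by
  have shannonEntropy_eq (n : ℕ) : shannonEntropy (law μ (j n ∘ α)) =
      ∑' t, law μ α t * -Real.log (law μ (j n ∘ α) (j n t)) :=
    (hasSum_shannonEntropy_comp μ hα (j n)).tsum_eq.symm
  simp only [toReal_partitionEntropy, shannonEntropy_eq]
  refine tendsto_tsum_of_dominated_convergence (hasSum_negMulLog_law μ hH).summable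
    (fun t => ?_) (.of_forall fun n t => ?_)
  · rw [Real.negMulLog, neg_mul, ← mul_neg]
    rcases eq_or_ne (law μ α t) 0 with h0 | h0
    · simp [h0]
    · exact (((hj.tendsto_law hα h0).log h0).neg).const_mul _
  · rw [Real.norm_of_nonneg]
    · exact law_mul_neg_log_law_comp_le μ α (j n) t
    · exact mul_nonneg (law_nonneg _ _ _)
        (neg_nonneg.2 (Real.log_nonpos (law_nonneg _ _ _) measureReal_le_one))

theorem eventually_exists_measureReal_ne_le {A : Type*} (a : ι → A) {δ : ℝ} (hδ : 0 < δ) :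
    ∀ᶠ n in atTop, ∃ θ : B n → A, μ.real {x | (a ∘ α) x ≠ (θ ∘ j n ∘ α) x} ≤ δ := by
  have : Nonempty ι := μ.nonempty_of_neZero.map α
  obtain ⟨T, hT, hlt⟩ := exists_finset_lt_sum_law μ hα hδ
  filter_upwards [hj.eventually_injOn hT] with n hn
  refine ⟨a ∘ Function.invFunOn (j n) T, ?_⟩
  have hsubset : {x | (a ∘ α) x ≠ ((a ∘ Function.invFunOn (j n) T) ∘ j n ∘ α) x} ⊆
      (α ⁻¹' T)ᶜ := by
    intro x hx hxT
    refine hx ?_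
    simp only [Function.comp_apply]
    rw [hn.leftInvOn_invFunOn hxT]
  have hsum : ∑ t ∈ T, law μ α t = μ.real (α ⁻¹' T) :=
    sum_measureReal_preimage_singleton T fun t _ => hα t
  refine (measureReal_mono hsubset).trans ?_
  rw [probReal_compl_eq_one_sub (hα.measurableSet_preimage _)]
  linarith

end IsSeparating

end Separating

/-! ### Chains -/

section Chain

variable {X ι κ : Type*} [MeasurableSpace X] {μ : Measure X} {u : ℕ → ℕ}

theorem frequently_eq_of_law_ne_zero {α : X → ι} {t : ι} (ht : law μ α t ≠ 0) :
    ∃ᶠ x in ae μ, α x = t :=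
  frequently_ae_iff.2 fun h0 => ht (congrArg ENNReal.toReal h0)

theorem Refines.exists_ae_eq_comp [Countable ι] {α : X → ι} {β : X → κ} (h : Refines μ α β) :
    ∃ θ : ι → κ, β =ᵐ[μ] θ ∘ α := by
  choose θ hθ using h
  refine ⟨θ, measure_mono_null (t := ⋃ t, α ⁻¹' {t} \ β ⁻¹' {θ t}) (fun x hx => ?_)
    (measure_iUnion_null hθ)⟩
  exact Set.mem_iUnion.2 ⟨α x, rfl, hx⟩

theorem refines_of_forall_eq [Nonempty X] {α : X → ι} {β : X → κ}
    (h : ∀ x y, α x = α y → β x = β y) : Refines μ α β := by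
  intro t
  by_cases ht : ∃ x, α x = t
  · obtain ⟨x, rfl⟩ := ht
    refine ⟨β x, ?_⟩
    have hsubset : α ⁻¹' {α x} ⊆ β ⁻¹' {β x} := fun y hy => h y x hy
    rw [Set.sdiff_eq_empty.2 hsubset, measure_empty]
  · push Not at ht
    refine ⟨β (Classical.arbitrary X), ?_⟩
    rw [Set.preimage_singleton_eq_empty.2 (by simpa using ht), Set.empty_sdiff, measure_empty]

theorem IsChain.exists_isSeparating [Countable ι] {α : X → ι} {a : ∀ n, X → Fin (u n)}
    (ha : IsChain μ α u a) :
    ∃ j : ∀ n, ι → Fin (u n), (∀ n, a n =ᵐ[μ] j n ∘ α) ∧ IsSeparating μ α j := by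
  choose j hj using fun n => (ha.le n).exists_ae_eq_comp
  choose θ hθ using fun n => (ha.mono n).exists_ae_eq_comp
  refine ⟨j, hj, fun t t' htt ht ht' => ?_⟩
  have eq_θ (n : ℕ) {s : ι} (hs : law μ α s ≠ 0) : j n s = θ n (j (n + 1) s) := by
    obtain ⟨x, rfl, hn, hsucc, hθx⟩ := ((frequently_eq_of_law_ne_zero hs).and_eventually
      ((hj n).and ((hj (n + 1)).and (hθ n)))).exists
    exact hn.symm.trans (hθx.trans (congrArg (θ n) hsucc))
  have exists_ne : ∃ n, j n t ≠ j n t' := by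
    by_contra! heq
    obtain ⟨k, hk⟩ := ha.join fun n => j n t
    have eq_k {s : ι} (hs : law μ α s ≠ 0) (hst : ∀ n, j n s = j n t) : s = k := by
      have hk' : ∀ᵐ x ∂μ, (∀ n, a n x = j n t) → α x = k := by
        rw [ae_iff]
        convert hk using 2
        ext x
        simp [funext_iff]
      obtain ⟨x, rfl, hx, hxk⟩ := ((frequently_eq_of_law_ne_zero hs).and_eventually
        ((ae_all_iff.2 hj).and hk')).exists
      exact hxk fun n => (hx n).trans (hst n)
    exact htt ((eq_k ht fun _ => rfl).trans (eq_k ht' fun n => (heq n).symm).symm)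
  obtain ⟨n, hn⟩ := exists_ne
  refine eventually_atTop.2 ⟨n, fun k hk => Nat.le_induction hn (fun k _ ih heq => ih ?_) k hk⟩
  rw [eq_θ k ht, eq_θ k ht', heq]

theorem isChain_comp [Nonempty X] [Countable ι] {α : X → ι} (hα : IsMeasurablePartition α)
    {j : ∀ n, ι → Fin (u n)} (hmono : ∀ n t t', j (n + 1) t = j (n + 1) t' → j n t = j n t')
    (hinj : ∀ t t', (∀ n, j n t = j n t') → t = t') : IsChain μ α u fun n => j n ∘ α where
  measurable n := hα.comp (j n)
  mono n := refines_of_forall_eq fun x y => hmono n (α x) (α y)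
  le n := refines_of_forall_eq fun _ _ h => congrArg (j n) h
  join := refines_of_forall_eq fun _ _ h => hinj _ _ (congrFun h)

/-- Truncation of labels at `n`: all labels from `n` on are merged. Composed with an injection into
`ℕ`, it gives the standard chain of a countable partition. -/
def truncate (n k : ℕ) : Fin (n + 1) := ⟨min k n, by omega⟩

theorem truncate_eq_truncate_iff {n k k' : ℕ} : truncate n k = truncate n k' ↔ min k n = min k' n :=
  Fin.mk_eq_mk

theorem isChain_truncate [Nonempty X] [Countable ι] {α : X → ι} (hα : IsMeasurablePartition α)
    {e : ι → ℕ} (he : Function.Injective e) :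
    IsChain μ α (fun n => n + 1) fun n => (truncate n ∘ e) ∘ α := by
  refine isChain_comp hα (fun n t t' h => ?_) fun t t' h => he ?_
  · simp only [Function.comp_apply, truncate_eq_truncate_iff] at h ⊢
    omega
  · have := truncate_eq_truncate_iff.1 (h (max (e t) (e t')))
    omega

theorem isSeparating_truncate (μ : Measure X) (α : X → ι) {e : ι → ℕ} (he : Function.Injective e) :
    IsSeparating μ α fun n => truncate n ∘ e := by
  intro t t' h _ _
  filter_upwards [eventually_ge_atTop (max (e t) (e t'))] with n hn heq
  refine h (he ?_)
  have := truncate_eq_truncate_iff.1 heq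
  omega

end Chain

/-! ### All chains have the same limit -/

section Limit

variable {G X ι : Type*} [Group G] [MulAction G X] [MeasurableSpace X] {u w : ℕ → ℕ}
  (S : MapSequence G)

theorem finEntropyAt_congr_ae {A : Type*} {μ : Measure X} [IsFiniteMeasure μ]
    [SMulInvariantMeasure G X μ] {α α' : X → A} (h : α =ᵐ[μ] α') (F : Finset G) :
    finEntropyAt S μ α F = finEntropyAt S μ α' F := by
  have ne_null : μ.real {x | α x ≠ α' x} = 0 := (measureReal_eq_zero_iff).2 h
  have orbitName_ae_eq : orbitName F α =ᵐ[μ] orbitName F α' := by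
    have h_le : μ.real {x | orbitName F α x ≠ orbitName F α' x} ≤ 0 := by
      simpa only [ne_null, mul_zero] using measureReal_orbitName_ne_le μ F α α'
    exact (measureReal_eq_zero_iff).1 (le_antisymm h_le measureReal_nonneg)
  refine finEntropyAt_congr S (funext fun φ => ?_)
  exact measureReal_congr (orbitName_ae_eq.fun_comp (· ∈ ({φ} : Set _)))

variable [Countable ι] [MeasurableConstSMul G X] {μ : Measure X} [IsProbabilityMeasure μ]
  [SMulInvariantMeasure G X μ] {α : X → ι} (hα : IsMeasurablePartition α)
  (hH : partitionEntropy μ α < ⊤) {F : Finset G} (hF : F.Nonempty)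
include hα hH

namespace IsSeparating

variable {B : ℕ → Type*} [∀ n, Finite (B n)] {k : ∀ n, ι → B n} (hk : IsSeparating μ α k)
include hk hF

theorem eventually_finEntropyAt_le {A : Type*} [Fintype A] (j : ι → A) {η ε : ℝ} (hη : 0 < η)
    (hε : 0 < ε) :
    ∀ᶠ m in atTop, finEntropyAt S μ (k m ∘ α) F ≤ finEntropyEps S μ (j ∘ α) F ε +
      (((partitionEntropy μ α).toReal - shannonEntropy (law μ (j ∘ α)) + η : ℝ) : EReal) := by
  have (n : ℕ) := Fintype.ofFinite (B n)
  have : (0 : ℝ) < F.card := Nat.cast_pos.2 hF.card_pos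
  obtain ⟨ε₁, hε₁, hcont⟩ :=
    exists_forall_l1Dist_le_abs_shannonEntropy_sub_lt (law μ (j ∘ α)) hη
  have hδ : 0 < min (ε / (4 * F.card)) (ε₁ / 2) := by positivity
  filter_upwards [hk.eventually_exists_measureReal_ne_le hα j hδ] with m ⟨θ, hθ⟩
  have hkα := hα.comp (k m)
  set d := μ.real {x | (j ∘ α) x ≠ (θ ∘ k m ∘ α) x}
  refine (finEntropyAt_le_of_l1Dist_comp_le μ S hkα (α' := j ∘ α) θ hF hε ?_).trans ?_
  · calc _ ≤ 2 * (F.card * d) := l1Dist_law_orbitName_le μ F (hα.comp j) (hkα.comp θ)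
      _ ≤ 2 * (F.card * (ε / (4 * F.card))) := by gcongr; exact hθ.trans (min_le_left _ _)
      _ = ε / 2 := by field_simp; norm_num
  · gcongr
    have hle := shannonEntropy_comp_le μ hα hH (k m)
    have hlaw := l1Dist_law_le_measureReal_ne μ (hα.comp j) (hkα.comp θ)
    have hd : d ≤ ε₁ / 2 := hθ.trans (min_le_right _ _)
    have := (abs_lt.1 (hcont _ (hlaw.trans (by linarith)))).1
    linarith

theorem limsup_finEntropyAt_le {A : Type*} [Fintype A] (j : ι → A) {η : ℝ} (hη : 0 < η) :
    limsup (fun n => finEntropyAt S μ (k n ∘ α) F) atTop ≤ finEntropyAt S μ (j ∘ α) F +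
      (((partitionEntropy μ α).toReal - shannonEntropy (law μ (j ∘ α)) + η : ℝ) : EReal) := by
  have := le_iInf_add_coe fun ε : {ε : ℝ // 0 < ε} =>
    limsup_le_of_le (h := hk.eventually_finEntropyAt_le S hα hH hF j hη ε.2)
  rwa [iInf_subtype] at this

theorem limsup_le_liminf {C : ℕ → Type*} [∀ n, Finite (C n)] {j : ∀ n, ι → C n}
    (hj : IsSeparating μ α j) :
    limsup (fun n => finEntropyAt S μ (k n ∘ α) F) atTop ≤
      liminf (fun n => finEntropyAt S μ (j n ∘ α) F) atTop := by
  have (n : ℕ) := Fintype.ofFinite (C n)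
  refine le_of_forall_pos_le_add_coe fun η hη => ?_
  rw [← EReal.sub_le_iff_le_add (.inl (EReal.coe_ne_bot η)) (.inl (EReal.coe_ne_top η))]
  refine le_liminf_of_le (h := ?_)
  filter_upwards [(hj.tendsto_shannonEntropy hα hH).eventually_const_lt
    (sub_lt_self _ (half_pos hη))] with n hn
  refine EReal.sub_le_of_le_add
    ((hk.limsup_finEntropyAt_le S hα hH hF (j n) (half_pos hη)).trans ?_)
  gcongr
  linarith

end IsSeparating

theorem limsup_le_liminf_of_isChain (hF : F.Nonempty) {a : ∀ n, X → Fin (u n)}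
    {b : ∀ n, X → Fin (w n)} (ha : IsChain μ α u a) (hb : IsChain μ α w b) :
    limsup (fun n => finEntropyAt S μ (b n) F) atTop ≤
      liminf (fun n => finEntropyAt S μ (a n) F) atTop := by
  obtain ⟨j, haj, hj⟩ := ha.exists_isSeparating
  obtain ⟨k, hbk, hk⟩ := hb.exists_isSeparating
  simp only [fun n => finEntropyAt_congr_ae S (haj n) F,
    fun n => finEntropyAt_congr_ae S (hbk n) F]
  exact hk.limsup_le_liminf S hα hH hF hj

theorem IsChain.tendsto_entropyAt {a : ∀ n, X → Fin (u n)} (ha : IsChain μ α u a)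
    (hF : F.Nonempty) :
    Tendsto (fun n => finEntropyAt S μ (a n) F) atTop (𝓝 (entropyAt S μ α F)) := by
  have tendsto_liminf := tendsto_of_le_liminf_of_limsup_le le_rfl
    (limsup_le_liminf_of_isChain S hα hH hF ha ha)
  convert tendsto_liminf
  refine le_antisymm (sInf_le ⟨u, a, ha, tendsto_liminf⟩) (le_sInf ?_)
  rintro L ⟨w, b, hb, hL⟩
  rw [← hL.liminf_eq, ← tendsto_liminf.limsup_eq]
  exact limsup_le_liminf_of_isChain S hα hH hF hb ha

theorem entropyAt_anti {F' : Finset G} (h : F ⊆ F') (hF' : F'.Nonempty) :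
    entropyAt S μ α F' ≤ entropyAt S μ α F := by
  refine le_sInf ?_
  rintro L ⟨w, b, hb, hL⟩
  exact le_of_tendsto_of_tendsto' (hb.tendsto_entropyAt S hα hH hF') hL
    fun n => finEntropyAt_anti S μ (hb.measurable n) h

theorem meanEntropy_eq_iInf_nonempty :
    meanEntropy S μ α = ⨅ F : {F : Finset G // F.Nonempty}, entropyAt S μ α F := by
  classical
  refine le_antisymm (le_iInf fun F => iInf_le _ F.1) (le_iInf fun F => ?_)
  exact (iInf_le _ ⟨insert 1 F, Finset.insert_nonempty 1 F⟩).trans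
    (entropyAt_anti S hα hH (Finset.subset_insert 1 F) (Finset.insert_nonempty 1 F))

end Limit

/-! ### Approximation by local functions of a generating partition -/

section Local

variable {G X C : Type*} [Group G] [MulAction G X] {β : X → ℕ}

/-- `Q` is a local function of `β`: the value of `Q` depends on finitely many translates of a finite
truncation of `β` only. If this holds for a truncation level and a finite set of translates, then it
holds for all larger ones, and the definition is phrased in this form. -/
def IsLocal (G : Type*) {X C : Type*} [Group G] [MulAction G X] (β : X → ℕ) (Q : X → C) : Prop :=
  ∀ᶠ p : ℕ × Finset G in atTop,
    ∃ Φ : (p.2 → Fin (p.1 + 1)) → C, Q = Φ ∘ orbitName p.2 (truncate p.1 ∘ β)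

theorem isLocal_comp_orbitName (n : ℕ) (L : Finset G) (Φ : (L → Fin (n + 1)) → C) :
    IsLocal G β (Φ ∘ orbitName L (truncate n ∘ β)) := by
  classical
  refine eventually_atTop.2 ⟨(n, L), fun p hp =>
    ⟨fun ψ => Φ fun l => truncate n (ψ ⟨l, hp.2 l.2⟩), funext fun x => congrArg Φ ?_⟩⟩
  funext l
  have := hp.1
  simp only [orbitName, Function.comp_apply, truncate, Fin.mk.injEq]
  omega

namespace IsLocal

theorem comp {D : Type*} {Q : X → C} (hQ : IsLocal G β Q) (θ : C → D) : IsLocal G β (θ ∘ Q) :=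
  hQ.mono fun _ ⟨Φ, hΦ⟩ => ⟨θ ∘ Φ, by rw [hΦ, Function.comp_assoc]⟩

theorem pi {J : Type*} [Finite J] {Q : J → X → C} (hQ : ∀ j, IsLocal G β (Q j)) :
    IsLocal G β fun x j => Q j x := by
  filter_upwards [eventually_all.2 hQ] with p hp
  choose Φ hΦ using hp
  exact ⟨fun ψ j => Φ j ψ, funext fun x => funext fun j => congrFun (hΦ j) x⟩

theorem exists_eq {Q : X → C} (hQ : IsLocal G β Q) :
    ∃ (n : ℕ) (L : Finset G), ∃ Φ : (L → Fin (n + 1)) → C,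
      Q = Φ ∘ orbitName L (truncate n ∘ β) := by
  classical
  obtain ⟨p, hp⟩ := hQ.exists
  exact ⟨p.1, p.2, hp⟩

theorem isMeasurablePartition [MeasurableSpace X] [MeasurableConstSMul G X]
    (hβ : IsMeasurablePartition β) {Q : X → C} (hQ : IsLocal G β Q) : IsMeasurablePartition Q := by
  obtain ⟨n, L, Φ, rfl⟩ := hQ.exists_eq
  exact ((hβ.comp (truncate n)).orbitName L).comp Φ

end IsLocal

/-- The sets whose membership predicate is a local function of `β`. -/
def localSets (G : Type*) {X : Type*} [Group G] [MulAction G X] (β : X → ℕ) : Set (Set X) :=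
  {s | IsLocal G β (· ∈ s)}

theorem isSetAlgebra_localSets (β : X → ℕ) : IsSetAlgebra (localSets G β) where
  empty_mem := isLocal_comp_orbitName 0 ∅ fun _ => False
  compl_mem _ hs := hs.comp Not
  union_mem s t hs ht := by
    have hst : ∀ b : Bool, IsLocal G β (· ∈ cond b s t) := Bool.forall_bool.2 ⟨ht, hs⟩
    exact (IsLocal.pi hst).comp fun P => P true ∨ P false

theorem generateFrom_smul_preimage_le (β : X → ℕ) :
    MeasurableSpace.generateFrom {s : Set X | ∃ (g : G) (i : ℕ), s = g • (β ⁻¹' {i})} ≤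
      MeasurableSpace.generateFrom (localSets G β) := by
  refine MeasurableSpace.generateFrom_le ?_
  rintro s ⟨g, i, rfl⟩
  refine MeasurableSpace.measurableSet_generateFrom ?_
  have mem_eq : (· ∈ g • (β ⁻¹' {i})) =
      (fun ψ : ({g} : Finset G) → Fin (i + 1 + 1) => (ψ ⟨g, by simp⟩ : ℕ) = i) ∘
        orbitName {g} (truncate (i + 1) ∘ β) := by
    refine funext fun x => propext ?_
    simp only [Set.mem_smul_set_iff_inv_smul_mem, Set.mem_preimage, Set.mem_singleton_iff,
      orbitName, Function.comp_apply, truncate]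
    omega
  change IsLocal G β (· ∈ g • (β ⁻¹' {i}))
  exact mem_eq ▸ isLocal_comp_orbitName _ _ _

variable [MeasurableSpace X] [MeasurableConstSMul G X] {μ : Measure X} [IsProbabilityMeasure μ]
  (hβ : IsMeasurablePartition β) (hgen : IsGenerating G μ β)

include hβ in
theorem generateFrom_localSets_le :
    MeasurableSpace.generateFrom (localSets G β) ≤ (inferInstance : MeasurableSpace X) := by
  refine MeasurableSpace.generateFrom_le fun s hs => ?_
  have := IsLocal.isMeasurablePartition hβ hs True
  simpa [Set.preimage] using this

include hβ hgen

theorem exists_localSet_measureReal_symmDiff_le {A : Set X} (hA : MeasurableSet A) {δ : ℝ}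
    (hδ : 0 < δ) : ∃ t ∈ localSets G β, μ.real (symmDiff A t) ≤ δ := by
  obtain ⟨A', hA', hAA'⟩ := hgen A hA
  have hle := generateFrom_localSets_le (G := G) hβ
  have hA'local := generateFrom_smul_preimage_le β A' hA'
  have hfin : IsFiniteMeasure (μ.trim hle) := isFiniteMeasure_trim hle
  have hdense := @Measure.MeasureDense.of_generateFrom_isSetAlgebra_finite X
    (MeasurableSpace.generateFrom (localSets G β)) (μ.trim hle) (localSets G β) hfin
    (isSetAlgebra_localSets β) rfl
  obtain ⟨t, ht, htA⟩ := @Measure.MeasureDense.approx X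
    (MeasurableSpace.generateFrom (localSets G β)) _ _ hdense A' hA'local
    (@measure_ne_top X (MeasurableSpace.generateFrom (localSets G β)) (μ.trim hle) hfin A') δ hδ
  refine ⟨t, ht, ENNReal.toReal_le_of_le_ofReal hδ.le ?_⟩
  rw [trim_measurableSet_eq hle
    (hA'local.symmDiff (MeasurableSpace.measurableSet_generateFrom ht))] at htA
  calc μ (symmDiff A t) ≤ μ (symmDiff A A') + μ (symmDiff A' t) := measure_symmDiff_le A A' t
    _ ≤ ENNReal.ofReal δ := by rw [hAA', zero_add]; exact htA.le

theorem exists_isLocal_measureReal_ne_le [Finite C] {Q : X → C} (hQ : IsMeasurablePartition Q)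
    {δ : ℝ} (hδ : 0 < δ) : ∃ Q' : X → C, IsLocal G β Q' ∧ μ.real {x | Q x ≠ Q' x} ≤ δ := by
  have := Fintype.ofFinite C
  have : Nonempty C := μ.nonempty_of_neZero.map Q
  have hpos : 0 < δ / Fintype.card C := div_pos hδ (Nat.cast_pos.2 Fintype.card_pos)
  choose t ht htQ using fun c => exists_localSet_measureReal_symmDiff_le hβ hgen (hQ c) hpos
  refine ⟨_, (IsLocal.pi ht).comp fun P => Classical.epsilon P, ?_⟩
  have hsubset : {x | Q x ≠ Classical.epsilon fun c => x ∈ t c} ⊆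
      ⋃ c ∈ Finset.univ, symmDiff (Q ⁻¹' {c}) (t c) := by
    intro x hx
    by_contra hnot
    have mem_iff (c : C) : x ∈ t c ↔ Q x = c := by
      simp only [Finset.mem_univ, Set.iUnion_true, Set.mem_iUnion, not_exists] at hnot
      have := hnot c
      simp only [Set.mem_symmDiff, Set.mem_preimage, Set.mem_singleton_iff] at this
      tauto
    exact hx ((mem_iff _).1 (Classical.epsilon_spec (p := fun c => x ∈ t c)
      ⟨Q x, (mem_iff _).2 rfl⟩))
  calc _ ≤ μ.real (⋃ c ∈ Finset.univ, symmDiff (Q ⁻¹' {c}) (t c)) :=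
        measureReal_mono hsubset (measure_ne_top _ _)
    _ ≤ ∑ c, μ.real (symmDiff (Q ⁻¹' {c}) (t c)) := measureReal_biUnion_finset_le _ _
    _ ≤ ∑ _c : C, δ / Fintype.card C := Finset.sum_le_sum fun c _ => htQ c
    _ = δ := by
      rw [Finset.sum_const, nsmul_eq_mul, Finset.card_univ]
      field_simp

end Local

/-! ### Independence of the generating partition -/

section Generator

variable {G X A B C E : Type*} [Group G] [MulAction G X]

section Codes

variable {m : ℕ} {σ : G → Equiv.Perm (Fin m)}

theorem l1Dist_law_comp_orbitName_le [MeasurableSpace X] [MeasurableConstSMul G X]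
    (μ : Measure X) [IsFiniteMeasure μ] [Finite A] [Finite E] {β : X → A}
    (hβ : IsMeasurablePartition β) {T : Finset G} {τ : ℝ} {b : Fin m → A}
    (hb : b ∈ approxPartitions μ σ T β τ) {N : Set (Fin m)} (f : (T → A) → E) (g : Fin m → E)
    (hfg : ∀ v ∉ N, f (modelName σ T b v) = g v) :
    l1Dist (law μ (f ∘ orbitName T β)) (law (uniformMeasure m) g) ≤
      τ + 2 * (uniformMeasure m).real N := by
  have hsub : {v | (f ∘ modelName σ T b) v ≠ g v} ⊆ N := fun v hv => by
    by_contra hN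
    exact hv (hfg v hN)
  calc _ ≤ _ := l1Dist_triangle _ (law (uniformMeasure m) (f ∘ modelName σ T b)) _
    _ ≤ _ := add_le_add
      (l1Dist_law_comp_le μ (uniformMeasure m) (hβ.orbitName T)
        (isMeasurablePartition_of_discrete (modelName σ T b)) f)
      (l1Dist_law_le_measureReal_ne (uniformMeasure m)
        (isMeasurablePartition_of_discrete (f ∘ modelName σ T b))
        (isMeasurablePartition_of_discrete g))
    _ ≤ τ + 2 * (uniformMeasure m).real N := by
      gcongr
      · exact mem_approxPartitions.1 hb
      · exact measure_ne_top _ _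

variable [DecidableEq G] {D : Finset G}

/-- The code `Φ`, which reads `D`-names, applied to a `D * D`-name at every place `d ∈ D`. -/
def codeNames (Φ : (D → A) → B) (ψ : (D * D : Finset G) → A) (d : D) : B :=
  Φ fun e => ψ ⟨d * e, Finset.mul_mem_mul d.2 e.2⟩

theorem orbitName_comp_orbitName (Φ : (D → A) → B) (β : X → A) (x : X) :
    orbitName D (Φ ∘ orbitName D β) x = codeNames Φ (orbitName (D * D) β x) := by
  refine funext fun d => congrArg Φ (funext fun e => ?_)
  simp only [orbitName, mul_inv_rev, mul_smul]

theorem modelName_comp_modelName (Φ : (D → A) → B) (b : Fin m → A) {v : Fin m}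
    (hv : v ∉ badSet σ D) :
    modelName σ D (Φ ∘ modelName σ D b) v = codeNames Φ (modelName σ (D * D) b v) :=
  funext fun d => congrArg Φ (funext fun e =>
    congrArg b (symm_symm_eq_of_notMem_badSet hv d.2 e.2))

theorem l1Dist_law_code_le [MeasurableSpace X] [MeasurableConstSMul G X] (μ : Measure X)
    [IsFiniteMeasure μ] [Finite A] [Finite E] {β : X → A} (hβ : IsMeasurablePartition β)
    (hD : 1 ∈ D) {τ : ℝ} {b : Fin m → A} (hb : b ∈ approxPartitions μ σ (D * D) β τ)
    (hbad : (uniformMeasure m).real (badSet σ D) ≤ τ / 2) (Φ : (D → A) → B)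
    (θ : A → (D → B) → E) :
    l1Dist (law μ fun x => θ (β x) (orbitName D (Φ ∘ orbitName D β) x))
      (law (uniformMeasure m) fun v => θ (b v) (modelName σ D (Φ ∘ modelName σ D b) v)) ≤
        2 * τ := by
  have one_mem : (1 : G) ∈ D * D := by simpa using Finset.mul_mem_mul hD hD
  let f (ψ : (D * D : Finset G) → A) : E := θ (ψ ⟨1, one_mem⟩) (codeNames Φ ψ)
  have f_orbitName : (fun x => θ (β x) (orbitName D (Φ ∘ orbitName D β) x)) =
      f ∘ orbitName (D * D) β := by
    funext x
    simp [f, orbitName_comp_orbitName, orbitName]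
  have f_modelName (v) (hv : v ∉ badSet σ D) : f (modelName σ (D * D) b v) =
      θ (b v) (modelName σ D (Φ ∘ modelName σ D b) v) := by
    have one_symm : (σ 1).symm v = v := by
      simpa using symm_symm_eq_of_notMem_badSet hv hD hD
    simp only [f, modelName_comp_modelName Φ b hv]
    simp only [modelName, one_symm]
  rw [f_orbitName]
  linarith [l1Dist_law_comp_orbitName_le μ hβ hb f _ f_modelName]

end Codes

variable [MeasurableSpace X] (μ : Measure X) [IsProbabilityMeasure μ]

theorem exists_ncard_near_diagonal_le [Finite C] {c : X → C} (hc : IsMeasurablePartition c)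
    {η : ℝ} (hη : 0 < η) :
    ∃ ε > 0, ∀ (m : ℕ) [NeZero m] (d : Fin m → C),
      ({w : Fin m → C | l1Dist (law μ fun x => (c x, c x))
        (law (uniformMeasure m) fun v => (w v, d v)) ≤ ε}.ncard : ℝ) ≤ Real.exp (m * η) := by
  have := Fintype.ofFinite C
  obtain ⟨ε, hε, hcount⟩ := exists_ncard_fiber_le Prod.snd (law μ fun x => (c x, c x))
    (law_nonneg μ _) hη
  have hdiag : IsMeasurablePartition fun x => (c x, c x) := hc.comp fun t => (t, t)
  have entropy_diag : shannonEntropy (law μ fun x => (c x, c x)) = shannonEntropy (law μ c) :=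
    shannonEntropy_law_comp_of_injective (π := fun t : C => (t, t))
      (fun _ _ h => congrArg Prod.fst h) μ c
  have entropy_snd : shannonEntropy (pushforward Prod.snd (law μ fun x => (c x, c x))) =
      shannonEntropy (law μ c) := by
    rw [← law_comp μ hdiag Prod.snd]
    rfl
  simp only [entropy_diag, entropy_snd, sub_self, zero_add] at hcount
  refine ⟨ε, hε, fun m _ d => le_trans (Nat.cast_le.2 ?_) (hcount m d)⟩
  exact Set.ncard_le_ncard_of_injOn (fun w v => (w v, d v)) (fun w hw => ⟨rfl, hw⟩)
    fun w _ w' _ h => funext fun v => congrArg Prod.fst (congrFun h v)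

variable [MeasurableConstSMul G X] [SMulInvariantMeasure G X μ]

-- A model `b` of `β` is encoded as the model `Φ ∘ modelName σ D b` of `α`, from which `Ψ` recovers
-- `π ∘ b` up to a small error; the remaining information is the conditional entropy of `β` given
-- `π ∘ β`.
theorem finEntropyAt_mul_le_of_codes [DecidableEq G] [Fintype A] [Finite B] [Fintype C]
    {S : MapSequence G} (hS : S.IsSofic) {β : X → A} (hβ : IsMeasurablePartition β)
    (α : X → B) (π : A → C) {D F L : Finset G} (hD : 1 ∈ D) (hF : F ⊆ D) (hL : L ⊆ D)
    (Φ : (D → A) → B) (Ψ : (L → B) → C) {ε ε' η : ℝ} (hε : 0 < ε) (hε' : 0 < ε') (hη : 0 < η)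
    (hcount : ∀ (m : ℕ) [NeZero m] (d : Fin m → C),
      ({w : Fin m → C | l1Dist (law μ fun x => (π (β x), π (β x)))
        (law (uniformMeasure m) fun v => (w v, d v)) ≤ ε'}.ncard : ℝ) ≤ Real.exp (m * η))
    (hΦ : l1Dist (law μ (orbitName F α)) (law μ (orbitName F (Φ ∘ orbitName D β))) ≤ ε / 2)
    (hΨ : l1Dist (law μ fun x => (π (β x), π (β x)))
      (law μ fun x => (π (β x), Ψ (orbitName L (Φ ∘ orbitName D β) x))) ≤ ε' / 2) :
    finEntropyAt S μ β (D * D) ≤ finEntropyEps S μ α F ε +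
      ((shannonEntropy (law μ β) - shannonEntropy (law μ (π ∘ β)) + 2 * η : ℝ) : EReal) := by
  obtain ⟨ε₀, hε₀, hfiber⟩ := exists_ncard_fiber_le π (law μ β) (law_nonneg μ β) hη
  rw [← law_comp μ hβ π] at hfiber
  set τ := min (min (ε / 4) (ε' / 4)) ε₀
  have hτ : 0 < τ := by positivity
  have hτε : τ ≤ ε / 4 := (min_le_left _ _).trans (min_le_left _ _)
  have hτε' : τ ≤ ε' / 4 := (min_le_left _ _).trans (min_le_right _ _)
  have hDD : (D * D).Nonempty := ⟨1 * 1, Finset.mul_mem_mul hD hD⟩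
  refine (iInf₂_le _ hτ).trans (finEntropyEps_le_of_ncard_le S ?_)
  filter_upwards [hS.eventually_uniformMeasure_badSet_le D (half_pos hτ)] with i hbad
  refine ncard_le_ncard_mul_of_fiber_le (f := fun b => Φ ∘ modelName (S.σ i) D b)
    (fun b hb => mem_approxPartitions.2 ?_) fun a _ => ?_
  · have hmodel := l1Dist_law_code_le μ hβ hD hb hbad Φ fun _ φ (f : F) => φ ⟨f, hF f.2⟩
    calc _ ≤ _ := l1Dist_triangle _ _ _
      _ ≤ ε / 2 + 2 * τ := add_le_add hΦ hmodel
      _ ≤ ε := by linarith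
  let T : Set (Fin (S.m i) → C) := {w | l1Dist (law μ fun x => (π (β x), π (β x)))
    (law (uniformMeasure (S.m i)) fun v => (w v, Ψ (modelName (S.σ i) L a v))) ≤ ε'}
  calc _ ≤ T.ncard * Real.exp (S.m i *
        (shannonEntropy (law μ β) - shannonEntropy (law μ (π ∘ β)) + η)) := by
        refine ncard_le_ncard_mul_of_fiber_le (f := fun b => π ∘ b) ?_ fun w _ =>
          le_trans (Nat.cast_le.2 (Set.ncard_le_ncard ?_)) (hfiber _ w)
        · rintro b ⟨hb, rfl⟩
          have hmodel := l1Dist_law_code_le μ hβ hD hb hbad Φ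
            fun t φ => (π t, Ψ fun l => φ ⟨l, hL l.2⟩)
          calc _ ≤ _ := l1Dist_triangle _ _ _
            _ ≤ ε' / 2 + 2 * τ := add_le_add hΨ hmodel
            _ ≤ ε' := by linarith
        · rintro b ⟨⟨hb, -⟩, hw⟩
          exact ⟨hw, (l1Dist_law_le_l1Dist_law_modelName μ (S.σ i) hDD hβ b).trans
            ((mem_approxPartitions.1 hb).trans (min_le_right _ _))⟩
    _ ≤ Real.exp (S.m i * η) * Real.exp (S.m i *
        (shannonEntropy (law μ β) - shannonEntropy (law μ (π ∘ β)) + η)) := by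
        gcongr
        exact hcount _ _
    _ = _ := by
        rw [← Real.exp_add]
        ring_nf

theorem natCast_mul_div_add_one_le (n : ℕ) {ε : ℝ} (hε : 0 ≤ ε) : n * (ε / (n + 1)) ≤ ε := by
  calc n * (ε / (n + 1)) ≤ (n + 1) * (ε / (n + 1)) := by gcongr; linarith
    _ = ε := by field_simp

theorem l1Dist_law_diag_le [Finite B] [Finite C] {c : X → C} (hc : IsMeasurablePartition c)
    (α : X → B) {α' : X → B} (hα' : IsMeasurablePartition α') {L : Finset G} (Ψ : (L → B) → C) :
    l1Dist (law μ fun x => (c x, c x)) (law μ fun x => (c x, Ψ (orbitName L α' x))) ≤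
      2 * (μ.real {x | c x ≠ Ψ (orbitName L α x)} + L.card * μ.real {x | α x ≠ α' x}) := by
  have hpair : IsMeasurablePartition fun x => (c x, Ψ (orbitName L α' x)) :=
    fun t => (measurable_id.prodMk measurable_id)
      (hc.prodPartition ((hα'.orbitName L).comp Ψ) t)
  have hsub : {x | (c x, c x) ≠ (c x, Ψ (orbitName L α' x))} ⊆
      {x | c x ≠ Ψ (orbitName L α x)} ∪ {x | orbitName L α x ≠ orbitName L α' x} := by
    intro x hx
    by_contra hnot
    simp only [Set.mem_union, Set.mem_ofPred_eq, not_or, not_not] at hnot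
    exact hx (by rw [← hnot.2, ← hnot.1])
  calc _ ≤ _ := l1Dist_law_le_measureReal_ne μ (hc.comp fun t => (t, t)) hpair
    _ ≤ _ := by
      gcongr
      exact (measureReal_mono hsub (measure_ne_top μ _)).trans ((measureReal_union_le _ _).trans
        (add_le_add_right (measureReal_orbitName_ne_le μ L α α') _))

theorem meanEntropy_le_finEntropyEps_add [Finite B] {S : MapSequence G} (hS : S.IsSofic)
    {β : X → ℕ} (hβ : IsFiniteEntropyGenerator G μ β) {α : X → B} (hα : IsMeasurablePartition α)
    (M : ℕ) (F : Finset G) {L : Finset G} (Ψ : (L → B) → Fin (M + 1)) {ε ε' η : ℝ} (hε : 0 < ε)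
    (hε' : 0 < ε') (hη : 0 < η)
    (hcount : ∀ (m : ℕ) [NeZero m] (d : Fin m → Fin (M + 1)),
      ({w : Fin m → Fin (M + 1) | l1Dist (law μ fun x => (truncate M (β x), truncate M (β x)))
        (law (uniformMeasure m) fun v => (w v, d v)) ≤ ε'}.ncard : ℝ) ≤ Real.exp (m * η))
    (hΨ : μ.real {x | truncate M (β x) ≠ Ψ (orbitName L α x)} ≤ ε' / 8) :
    meanEntropy S μ β ≤ finEntropyEps S μ α F ε + (((partitionEntropy μ β).toReal -
      shannonEntropy (law μ (truncate M ∘ β)) + 2 * η : ℝ) : EReal) := by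
  classical
  have : Nonempty X := μ.nonempty_of_neZero
  obtain ⟨hβm, hβH, hβg⟩ := hβ
  have hδ : 0 < min (ε / 4 / (F.card + 1)) (ε' / 8 / (L.card + 1)) := by positivity
  obtain ⟨α', hα'loc, hα'⟩ := exists_isLocal_measureReal_ne_le hβm hβg hα hδ
  have hα'm := hα'loc.isMeasurablePartition hβm
  obtain ⟨⟨n₀, L₀⟩, hcode⟩ := eventually_atTop.1 hα'loc
  set D := insert 1 (F ∪ L ∪ L₀) with hD
  have one_mem : 1 ∈ D := Finset.mem_insert_self _ _
  have hFD : F ⊆ D := by grind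
  have hLD : L ⊆ D := by grind
  have hL₀D : L₀ ⊆ D := by grind
  have hDD : (D * D).Nonempty := ⟨1 * 1, Finset.mul_mem_mul one_mem one_mem⟩
  refine (iInf_le _ (D * D)).trans (le_of_tendsto
    ((isChain_truncate hβm Function.injective_id).tendsto_entropyAt S hβm hβH hDD) ?_)
  filter_upwards [eventually_ge_atTop (max n₀ M)] with n hn
  obtain ⟨hn₀, hM⟩ := max_le_iff.1 hn
  obtain ⟨Φ, rfl⟩ := hcode (n, D) ⟨hn₀, hL₀D⟩
  have truncate_eq (x : X) : truncate M (truncate n (β x) : ℕ) = truncate M (β x) :=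
    truncate_eq_truncate_iff.2 (by simp [truncate]; omega)
  refine (finEntropyAt_mul_le_of_codes μ hS (hβm.comp (truncate n)) α
    (fun k : Fin (n + 1) => truncate M k) one_mem hFD hLD Φ Ψ hε hε' hη
    (by simpa only [Function.comp_apply, truncate_eq] using hcount) ?_ ?_).trans ?_
  · calc _ ≤ 2 * (F.card * μ.real _) := l1Dist_law_orbitName_le μ F hα hα'm
      _ ≤ 2 * (F.card * (ε / 4 / (F.card + 1))) := by gcongr; exact hα'.trans (min_le_left _ _)
      _ ≤ 2 * (ε / 4) := by gcongr; exact natCast_mul_div_add_one_le _ (by positivity)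
      _ = ε / 2 := by ring
  · simp only [Function.comp_apply, truncate_eq]
    calc _ ≤ _ := l1Dist_law_diag_le μ (hβm.comp (truncate M)) α hα'm Ψ
      _ ≤ 2 * (ε' / 8 + L.card * (ε' / 8 / (L.card + 1))) := by
        gcongr
        · exact hΨ
        · exact hα'.trans (min_le_right _ _)
      _ ≤ 2 * (ε' / 8 + ε' / 8) := by gcongr; exact natCast_mul_div_add_one_le _ (by positivity)
      _ = ε' / 2 := by ring
  · have comp_eq : (fun k : Fin (n + 1) => truncate M k) ∘ truncate n ∘ β = truncate M ∘ β :=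
      funext truncate_eq
    rw [comp_eq]
    gcongr
    exact shannonEntropy_comp_le μ hβm hβH (truncate n)

theorem meanEntropy_le_of_isFiniteEntropyGenerator {S : MapSequence G} (hS : S.IsSofic)
    {α β : X → ℕ} (hα : IsFiniteEntropyGenerator G μ α) (hβ : IsFiniteEntropyGenerator G μ β) :
    meanEntropy S μ β ≤ meanEntropy S μ α := by
  classical
  have : Nonempty X := μ.nonempty_of_neZero
  obtain ⟨hαm, hαH, hαg⟩ := hα
  rw [meanEntropy_eq_iInf_nonempty S hαm hαH]
  refine le_iInf fun ⟨F, hF⟩ => le_of_forall_pos_le_add_coe fun η hη => ?_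
  rw [← EReal.sub_le_iff_le_add (.inl (EReal.coe_ne_bot _)) (.inl (EReal.coe_ne_top _))]
  have hη3 : 0 < η / 3 := by positivity
  have hsep : IsSeparating μ β truncate := isSeparating_truncate μ β Function.injective_id
  obtain ⟨M, hM⟩ := ((hsep.tendsto_shannonEntropy hβ.1 hβ.2.1).eventually_const_lt
    (sub_lt_self _ hη3)).exists
  obtain ⟨ε', hε', hcount⟩ := exists_ncard_near_diagonal_le μ (hβ.1.comp (truncate M)) hη3
  obtain ⟨b, hb, hdist⟩ := exists_isLocal_measureReal_ne_le hαm hαg (hβ.1.comp (truncate M))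
    (show 0 < ε' / 8 by positivity)
  obtain ⟨⟨N, L⟩, hcode⟩ := eventually_atTop.1 hb
  refine ge_of_tendsto
    ((isChain_truncate hαm Function.injective_id).tendsto_entropyAt S hαm hαH hF) ?_
  filter_upwards [eventually_ge_atTop N] with n hn
  obtain ⟨Ψ, rfl⟩ := hcode (n, L) ⟨hn, subset_rfl⟩
  rw [finEntropyAt, iInf_subtype']
  refine EReal.sub_le_of_le_add (le_iInf_add_coe fun ε => (meanEntropy_le_finEntropyEps_add μ hS hβ
    (hαm.comp (truncate n)) M F Ψ ε.2 hε' hη3 hcount hdist).trans ?_)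
  gcongr
  · rfl
  · linarith

theorem IsFiniteEntropyGenerator.hasSoficEntropy {S : MapSequence G} (hS : S.IsSofic)
    {α : X → ℕ} (hα : IsFiniteEntropyGenerator G μ α) :
    HasSoficEntropy S μ (meanEntropy S μ α) :=
  ⟨⟨α, hα⟩, fun _ hβ => le_antisymm (meanEntropy_le_of_isFiniteEntropyGenerator μ hS hα hβ)
    (meanEntropy_le_of_isFiniteEntropyGenerator μ hS hβ hα)⟩

end Generator

/-! ### Products with Bernoulli shifts -/

section Shift

variable {G K : Type*} [Group G] [MeasurableSpace K]

theorem canonicalPartition_inv_smul {K : Type*} (g : G) (y : Shift G K) :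
    canonicalPartition G K (g⁻¹ • y) = y g := by
  change y (g⁻¹⁻¹ * 1) = y g
  simp

theorem measurable_shift_eval {G : Type*} (g : G) : Measurable fun y : Shift G K => y g :=
  measurable_pi_apply (X := fun _ : G => K) g

instance : MeasurableConstSMul G (Shift G K) where
  measurable_const_smul g :=
    measurable_pi_lambda (X := fun _ : G => K) _ fun f => measurable_shift_eval (g⁻¹ * f)

theorem IsMeasurablePartition.comp_canonicalPartition {B : Type*} {c : K → B}
    (hc : IsMeasurablePartition c) : IsMeasurablePartition (c ∘ canonicalPartition G K) :=
  fun b => measurable_shift_eval 1 (hc b)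

variable (κ : Measure K) [IsProbabilityMeasure κ]

instance {G : Type*} : IsProbabilityMeasure (bernoulliMeasure G κ) :=
  inferInstanceAs (IsProbabilityMeasure (Measure.infinitePi fun _ : G => κ))

theorem measurePreserving_shift_eval {G : Type*} (g : G) :
    MeasurePreserving (fun y : Shift G K => y g) (bernoulliMeasure G κ) κ :=
  measurePreserving_eval_infinitePi (fun _ : G => κ) g

theorem measurePreserving_shift_smul (g : G) :
    MeasurePreserving (fun y : Shift G K => g • y) (bernoulliMeasure G κ)
      (bernoulliMeasure G κ) := by
  have smul_eq : (fun y : Shift G K => g • y) =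
      MeasurableEquiv.piCongrLeft (fun _ => K) (Equiv.mulLeft g) := by
    refine funext fun y => funext fun f => ?_
    obtain ⟨f, rfl⟩ := (Equiv.mulLeft g).surjective f
    exact (congrArg y (inv_mul_cancel_left g f)).trans
      (Equiv.piCongrLeft_apply_apply (fun _ => K) (Equiv.mulLeft g) y f).symm
  refine ⟨measurable_const_smul g, ?_⟩
  rw [smul_eq]
  exact Measure.infinitePi_map_piCongrLeft (fun _ : G => κ) (Equiv.mulLeft g)

instance : SMulInvariantMeasure G (Shift G K) (bernoulliMeasure G κ) where
  measure_preimage_smul g _ hs :=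
    (measurePreserving_shift_smul κ g).measure_preimage hs.nullMeasurableSet

variable {B : Type*} {c : K → B} (hc : IsMeasurablePartition c)
include hc

theorem law_comp_canonicalPartition :
    law (bernoulliMeasure G κ) (c ∘ canonicalPartition G K) = law κ c :=
  funext fun b =>
    (measurePreserving_shift_eval κ (1 : G)).measureReal_preimage (hc b).nullMeasurableSet

theorem law_orbitName_comp_canonicalPartition (F : Finset G) (ψ : F → B) :
    law (bernoulliMeasure G κ) (orbitName F (c ∘ canonicalPartition G K)) ψ =
      ∏ f, law (bernoulliMeasure G κ) (c ∘ canonicalPartition G K) (ψ f) := by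
  rw [law_comp_canonicalPartition κ hc]
  refine Eq.trans ?_ (infinitePi_real_forall_eq κ hc (u := ((↑) : F → G))
    Subtype.val_injective ψ)
  refine congrArg (bernoulliMeasure G κ).real (Set.ext fun y => ?_)
  simp only [Set.mem_preimage, Set.mem_singleton_iff, funext_iff, orbitName, Function.comp_apply,
    canonicalPartition_inv_smul]
  rfl

end Shift

section PartitionEntropy

variable {X Y ι κ : Type*} [MeasurableSpace X] [MeasurableSpace Y]

theorem partitionEntropy_congr {μ : Measure X} {ν : Measure Y} {α : X → ι} {β : Y → ι}
    (h : law μ α = law ν β) : partitionEntropy μ α = partitionEntropy ν β :=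
  tsum_congr fun t => congrArg (fun r => ENNReal.ofReal (Real.negMulLog r)) (congrFun h t)

theorem partitionEntropy_comp_of_injective (μ : Measure X) (α : X → ι) {e : ι → κ}
    (he : Function.Injective e) : partitionEntropy μ (e ∘ α) = partitionEntropy μ α := by
  unfold partitionEntropy
  rw [← he.tsum_eq fun s hs => ?_]
  · exact tsum_congr fun t =>
      congrArg (fun r => ENNReal.ofReal (Real.negMulLog r)) (law_comp_of_injective he μ α t)
  · by_contra hno
    have hempty : e ∘ α ⁻¹' {s} = ∅ :=
      Set.eq_empty_of_forall_notMem fun x hx => hno ⟨α x, hx⟩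
    simp [hempty] at hs

theorem partitionEntropy_prodPartition_lt_top [Countable ι] [Countable κ] (μ : Measure X)
    [IsProbabilityMeasure μ] (ν : Measure Y) [IsProbabilityMeasure ν] {α : X → ι} {β : Y → κ}
    (hα : IsMeasurablePartition α) (hβ : IsMeasurablePartition β) (hHα : partitionEntropy μ α < ⊤)
    (hHβ : partitionEntropy ν β < ⊤) :
    partitionEntropy (μ.prod ν) (prodPartition α β) < ⊤ := by
  have summable_left := (hasSum_negMulLog_law μ hHα).summable.mul_of_nonneg
    (hasSum_law ν hβ).summable (negMulLog_law_nonneg μ α) (law_nonneg ν β)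
  have summable_right := (hasSum_law μ hα).summable.mul_of_nonneg
    (hasSum_negMulLog_law ν hHβ).summable (law_nonneg μ α) (negMulLog_law_nonneg ν β)
  refine lt_of_eq_of_lt (tsum_congr fun ⟨t, s⟩ => ?_)
    (summable_left.add summable_right).tsum_ofReal_lt_top
  change ENNReal.ofReal (Real.negMulLog (law (μ.prod ν) (prodPartition α β) (t, s))) = _
  rw [law_prodPartition, Real.negMulLog_mul]
  congr 1
  ring

end PartitionEntropy

theorem isChain_truncate_prod {X ι κ : Type*} [MeasurableSpace X] [Nonempty X] [Countable ι]
    [Countable κ] {μ : Measure X} {γ : X → ι × κ} (hγ : IsMeasurablePartition γ) {e₁ : ι → ℕ}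
    {e₂ : κ → ℕ} (he₁ : Function.Injective e₁) (he₂ : Function.Injective e₂) :
    IsChain μ γ (fun n => (n + 1) * (n + 1)) fun n =>
      (finProdFinEquiv ∘ Prod.map (truncate n ∘ e₁) (truncate n ∘ e₂)) ∘ γ := by
  refine isChain_comp hγ (fun n t t' h => ?_) fun t t' h => Prod.ext (he₁ ?_) (he₂ ?_)
  all_goals
    simp only [Function.comp_apply, EmbeddingLike.apply_eq_iff_eq, Prod.map_apply', Prod.mk.injEq,
      truncate_eq_truncate_iff] at h ⊢
  · omega
  · have := (h (max (e₁ t.1) (e₁ t'.1))).1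
    omega
  · have := (h (max (e₂ t.2) (e₂ t'.2))).2
    omega

theorem law_of_unique {X A : Type*} [MeasurableSpace X] [Unique A] (μ : Measure X)
    [IsProbabilityMeasure μ] (g : X → A) (a : A) : law μ g a = 1 := by
  have hatom : g ⁻¹' {a} = Set.univ := Set.eq_univ_of_forall fun x => Subsingleton.elim (g x) a
  rw [law, hatom, probReal_univ]

theorem finEntropyAt_of_unique {G X A : Type*} [Group G] [MulAction G X] [MeasurableSpace X]
    [Unique A] (S : MapSequence G) (μ : Measure X) [IsProbabilityMeasure μ] (α : X → A)
    (F : Finset G) : finEntropyAt S μ α F = 0 := by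
  have approxPartitions_eq_univ (i : ℕ) {ε : ℝ} (hε : 0 < ε) :
      approxPartitions μ (S.σ i) F α ε = Set.univ := by
    refine Set.eq_univ_of_forall fun β => mem_approxPartitions.2 ?_
    have law_eq : law μ (orbitName F α) = law (uniformMeasure (S.m i)) (modelName (S.σ i) F β) :=
      funext fun φ => by rw [law_of_unique, law_of_unique]
    rw [law_eq, l1Dist_self]
    exact hε.le
  have finEntropyEps_eq_zero {ε : ℝ} (hε : 0 < ε) : finEntropyEps S μ α F ε = 0 := by
    simp [finEntropyEps, approxPartitions_eq_univ _ hε]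
  exact le_antisymm ((iInf₂_le 1 one_pos).trans (finEntropyEps_eq_zero one_pos).le)
    (le_iInf₂ fun ε hε => (finEntropyEps_eq_zero hε).ge)

section Bernoulli

variable {G K : Type*} [Group G] [MeasurableSpace K] (κ : Measure K) [IsProbabilityMeasure κ]
  {S : MapSequence G} (hS : S.IsSofic) {F : Finset G} (hF : F.Nonempty)
include hS hF

section Finite

variable {A B : Type*} [Fintype B]

section Product

variable {X : Type*} [MulAction G X] [MeasurableSpace X] [MeasurableConstSMul G X]
  (μ : Measure X) [IsProbabilityMeasure μ] [SMulInvariantMeasure G X μ]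

theorem finEntropyAt_prod_bernoulliMeasure [Finite A] {α : X → A}
    (hα : IsMeasurablePartition α) {c : K → B} (hc : IsMeasurablePartition c) :
    finEntropyAt S (μ.prod (bernoulliMeasure G κ)) (prodPartition α (c ∘ canonicalPartition G K)) F
      = finEntropyAt S μ α F + (shannonEntropy (law κ c) : EReal) := by
  rw [← law_comp_canonicalPartition (G := G) κ hc]
  exact finEntropyAt_prodPartition μ (bernoulliMeasure G κ) hS hα hc.comp_canonicalPartition hF
    (law_orbitName_comp_canonicalPartition κ hc F)

end Product

theorem finEntropyAt_bernoulliMeasure {c : K → B} (hc : IsMeasurablePartition c) :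
    finEntropyAt S (bernoulliMeasure G κ) (c ∘ canonicalPartition G K) F =
      (shannonEntropy (law κ c) : EReal) := by
  set ν := bernoulliMeasure G κ
  set β := c ∘ canonicalPartition G K
  have hα : IsMeasurablePartition fun _ : Shift G K => () := fun _ => by simp
  have hβ : IsMeasurablePartition β := hc.comp_canonicalPartition
  have horbit : orbitName F (Equiv.punitProd B ∘ prodPartition (fun _ : Shift G K => ()) β) =
    orbitName F β ∘ Prod.snd := rfl
  calc finEntropyAt S ν β F
      = finEntropyAt S (ν.prod ν)
          (Equiv.punitProd B ∘ prodPartition (fun _ : Shift G K => ()) β) F :=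
        finEntropyAt_congr S (by rw [horbit, law_comp_snd])
    _ = finEntropyAt S (ν.prod ν) (prodPartition (fun _ : Shift G K => ()) β) F :=
        finEntropyAt_equiv_comp (ν.prod ν) S (hα.prodPartition hβ) _ hF
    _ = shannonEntropy (law κ c) := by
        rw [finEntropyAt_prod_bernoulliMeasure κ hS hF ν hα hc, finEntropyAt_of_unique, zero_add]

end Finite

variable {ι J : Type*} [Countable J] {c : K → J} (hc : IsMeasurablePartition c)
  (hκ : partitionEntropy κ c < ⊤)
include hc hκ

theorem entropyAt_bernoulliMeasure :
    entropyAt S (bernoulliMeasure G κ) (c ∘ canonicalPartition G K) F =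
      (partitionEntropy κ c : EReal) := by
  have : Nonempty (Shift G K) := (bernoulliMeasure G κ).nonempty_of_neZero
  obtain ⟨e, he⟩ := Countable.exists_injective_nat J
  have hH : partitionEntropy (bernoulliMeasure G κ) (c ∘ canonicalPartition G K) < ⊤ :=
    (partitionEntropy_congr (law_comp_canonicalPartition (G := G) κ hc)).trans_lt hκ
  have tendsto_entropy := (isChain_truncate hc.comp_canonicalPartition he).tendsto_entropyAt
    (μ := bernoulliMeasure G κ) S hc.comp_canonicalPartition hH hF
  refine tendsto_nhds_unique tendsto_entropy ?_
  rw [← EReal.coe_ennreal_toReal hκ.ne]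
  refine (EReal.tendsto_coe.2
    ((isSeparating_truncate κ c he).tendsto_shannonEntropy hc hκ)).congr fun n => ?_
  exact (finEntropyAt_bernoulliMeasure κ hS hF (hc.comp (truncate n ∘ e))).symm

variable {X : Type*} [MulAction G X] [MeasurableSpace X] [MeasurableConstSMul G X]
  (μ : Measure X) [IsProbabilityMeasure μ] [SMulInvariantMeasure G X μ]

theorem entropyAt_prod_bernoulliMeasure [Countable ι] {α : X → ι}
    (hα : IsMeasurablePartition α) (hH : partitionEntropy μ α < ⊤) :
    entropyAt S (μ.prod (bernoulliMeasure G κ)) (prodPartition α (c ∘ canonicalPartition G K)) F =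
      entropyAt S μ α F + (partitionEntropy κ c : EReal) := by
  have : Nonempty X := μ.nonempty_of_neZero
  have : Nonempty (Shift G K) := (bernoulliMeasure G κ).nonempty_of_neZero
  obtain ⟨e₁, he₁⟩ := Countable.exists_injective_nat ι
  obtain ⟨e₂, he₂⟩ := Countable.exists_injective_nat J
  have hβ : IsMeasurablePartition (c ∘ canonicalPartition G K) := hc.comp_canonicalPartition
  have hHβ : partitionEntropy (bernoulliMeasure G κ) (c ∘ canonicalPartition G K) < ⊤ :=
    (partitionEntropy_congr (law_comp_canonicalPartition (G := G) κ hc)).trans_lt hκ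
  have tendsto_prod := (isChain_truncate_prod (hα.prodPartition hβ) he₁ he₂).tendsto_entropyAt
    S (hα.prodPartition hβ)
    (partitionEntropy_prodPartition_lt_top μ (bernoulliMeasure G κ) hα hβ hH hHβ) hF
  have tendsto_left := (isChain_truncate hα he₁).tendsto_entropyAt S hα hH hF
  have tendsto_right := EReal.tendsto_coe.2
    ((isSeparating_truncate κ c he₂).tendsto_shannonEntropy hc hκ)
  rw [EReal.coe_ennreal_toReal hκ.ne] at tendsto_right
  have hadd : Tendsto (fun n => finEntropyAt S μ ((truncate n ∘ e₁) ∘ α) F +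
      (shannonEntropy (law κ ((truncate n ∘ e₂) ∘ c)) : EReal)) atTop
      (𝓝 (entropyAt S μ α F + (partitionEntropy κ c : EReal))) :=
    (EReal.continuousAt_add (p := (_, _)) (.inr (EReal.coe_ennreal_ne_bot _))
      (.inr (EReal.coe_ennreal_eq_top_iff.not.2 hκ.ne))).tendsto.comp
        (tendsto_left.prodMk_nhds tendsto_right)
  refine tendsto_nhds_unique tendsto_prod (hadd.congr fun n => ?_)
  rw [← finEntropyAt_prod_bernoulliMeasure κ hS hF μ (hα.comp _) (hc.comp _)]
  exact (finEntropyAt_equiv_comp (μ.prod (bernoulliMeasure G κ)) S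
    ((hα.comp (truncate n ∘ e₁)).prodPartition (hc.comp (truncate n ∘ e₂)).comp_canonicalPartition)
    finProdFinEquiv hF).symm

end Bernoulli

/-! ### Generating partitions -/

section Generating

variable {G X Y ι J : Type*} [Group G] [MulAction G X]

/-- The smallest `G`-invariant σ-algebra containing the atoms of `α`, generated by their
translates. -/
abbrev invariantSpace (G : Type*) {X ι : Type*} [Group G] [MulAction G X] (α : X → ι) :
    MeasurableSpace X :=
  MeasurableSpace.generateFrom {s : Set X | ∃ (g : G) (i : ι), s = g • (α ⁻¹' {i})}

theorem measurableSet_invariantSpace_smul [Countable ι] (α : X → ι) (g : G) (T : Set ι) :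
    MeasurableSet[invariantSpace G α] (g • (α ⁻¹' T)) := by
  have hunion : g • (α ⁻¹' T) = ⋃ i ∈ T, g • (α ⁻¹' {i}) := by
    ext
    simp [Set.mem_smul_set_iff_inv_smul_mem]
  rw [hunion]
  exact MeasurableSet.biUnion T.to_countable fun i _ =>
    MeasurableSpace.measurableSet_generateFrom ⟨g, i, rfl⟩

theorem isGenerating_iff_le [MeasurableSpace X] {μ : Measure X} {α : X → ι} :
    IsGenerating G μ α ↔ (inferInstance : MeasurableSpace X) ≤
      eventuallyMeasurableSpace (invariantSpace G α) (ae μ) :=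
  forall₂_congr fun _ _ => exists_congr fun _ => and_congr_right' measure_symmDiff_eq_zero_iff

theorem IsGenerating.comp_of_injective [MeasurableSpace X] {μ : Measure X} {α : X → ι}
    (hα : IsGenerating G μ α) {e : ι → J} (he : Function.Injective e) :
    IsGenerating G μ (e ∘ α) := by
  have hle : invariantSpace G α ≤ invariantSpace G (e ∘ α) := by
    refine MeasurableSpace.generateFrom_mono ?_
    rintro _ ⟨g, i, rfl⟩
    refine ⟨g, e i, ?_⟩
    rw [Set.preimage_comp, ← Set.image_singleton, he.preimage_image]
  intro A hA
  obtain ⟨A', hA', h⟩ := hα A hA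
  exact ⟨A', hle A' hA', h⟩

theorem IsGenerating.comap_le [MulAction G Y] [MeasurableSpace X] [MeasurableSpace Y] [Countable J]
    {μ : Measure X} {ν : Measure Y} {f : Y → X} (hf : Measure.QuasiMeasurePreserving f ν μ)
    (hfG : ∀ (g : G) y, f (g • y) = g • f y) {α : X → ι} (hα : IsGenerating G μ α) {γ : Y → J}
    {r : J → ι} (hr : ∀ y, α (f y) = r (γ y)) :
    MeasurableSpace.comap f inferInstance ≤
      eventuallyMeasurableSpace (invariantSpace G γ) (ae ν) := by
  have hle : MeasurableSpace.comap f (invariantSpace G α) ≤ invariantSpace G γ := by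
    rw [invariantSpace, MeasurableSpace.comap_generateFrom]
    refine MeasurableSpace.generateFrom_le ?_
    rintro _ ⟨_, ⟨g, i, rfl⟩, rfl⟩
    convert measurableSet_invariantSpace_smul γ g (r ⁻¹' {i}) using 1
    ext y
    simp [Set.mem_smul_set_iff_inv_smul_mem, ← hfG, hr]
  rintro _ ⟨A, hA, rfl⟩
  obtain ⟨A', hA', h⟩ := hα A hA
  exact ⟨f ⁻¹' A', hle _ ⟨A', hA', rfl⟩, hf.preimage_ae_eq (measure_symmDiff_eq_zero_iff.1 h)⟩

theorem IsGenerating.prodPartition [MulAction G Y] [MeasurableSpace X] [MeasurableSpace Y]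
    [Countable ι] [Countable J] {μ : Measure X} {ν : Measure Y} {α : X → ι} {β : Y → J}
    (hα : IsGenerating G μ α) (hβ : IsGenerating G ν β) :
    IsGenerating G (μ.prod ν) (prodPartition α β) :=
  isGenerating_iff_le.2 <| sup_le
    (hα.comap_le Measure.quasiMeasurePreserving_fst (fun _ _ => rfl) (r := Prod.fst) fun _ => rfl)
    (hβ.comap_le Measure.quasiMeasurePreserving_snd (fun _ _ => rfl) (r := Prod.snd) fun _ => rfl)

theorem isGenerating_comp_canonicalPartition {K : Type*} [MeasurableSpace K] (κ : Measure K)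
    [IsProbabilityMeasure κ] [Countable ι] {c : K → ι}
    (hc : ∀ B : Set K, MeasurableSet B → ∃ T : Set ι, B =ᵐ[κ] c ⁻¹' T) :
    IsGenerating G (bernoulliMeasure G κ) (c ∘ canonicalPartition G K) := by
  refine isGenerating_iff_le.2 (iSup_le fun g => ?_)
  rintro _ ⟨B, hB, rfl⟩
  obtain ⟨T, hT⟩ := hc B hB
  refine ⟨g • ((c ∘ canonicalPartition G K) ⁻¹' T), measurableSet_invariantSpace_smul _ g T, ?_⟩
  have hset : g • ((c ∘ canonicalPartition G K) ⁻¹' T) =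
      (fun y : Shift G K => y g) ⁻¹' (c ⁻¹' T) := by
    ext
    simp [Set.mem_smul_set_iff_inv_smul_mem, canonicalPartition_inv_smul]
  rw [hset]
  exact (measurePreserving_shift_eval κ g).quasiMeasurePreserving.preimage_ae_eq hT

section Relabel

variable [MeasurableSpace X] [MeasurableConstSMul G X] [Countable ι] {S : MapSequence G}
  (μ : Measure X) [IsProbabilityMeasure μ] [SMulInvariantMeasure G X μ] {α : X → ι}
  (hα : IsMeasurablePartition α) (hH : partitionEntropy μ α < ⊤)
include hα hH

theorem entropyAt_comp_of_injective [Countable J] (S : MapSequence G) {e : ι → J}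
    (he : Function.Injective e) {F : Finset G} (hF : F.Nonempty) :
    entropyAt S μ (e ∘ α) F = entropyAt S μ α F := by
  have : Nonempty X := μ.nonempty_of_neZero
  obtain ⟨e', he'⟩ := Countable.exists_injective_nat J
  exact tendsto_nhds_unique
    ((isChain_truncate (hα.comp e) he').tendsto_entropyAt S (hα.comp e)
      ((partitionEntropy_comp_of_injective μ α he).trans_lt hH) hF)
    ((isChain_truncate hα (he'.comp he)).tendsto_entropyAt S hα hH hF)

theorem IsGenerating.hasSoficEntropy (hS : S.IsSofic) (hgen : IsGenerating G μ α) :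
    HasSoficEntropy S μ (meanEntropy S μ α) := by
  obtain ⟨e, he⟩ := Countable.exists_injective_nat ι
  have hHe : partitionEntropy μ (e ∘ α) < ⊤ :=
    (partitionEntropy_comp_of_injective μ α he).trans_lt hH
  have meanEntropy_eq : meanEntropy S μ (e ∘ α) = meanEntropy S μ α := by
    rw [meanEntropy_eq_iInf_nonempty S (hα.comp e) hHe, meanEntropy_eq_iInf_nonempty S hα hH]
    exact iInf_congr fun F => entropyAt_comp_of_injective μ hα hH S he F.2
  rw [← meanEntropy_eq]
  exact IsFiniteEntropyGenerator.hasSoficEntropy μ hS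
    ⟨hα.comp e, hHe, hgen.comp_of_injective he⟩

end Relabel

end Generating

section Base

variable {K : Type*} [MeasurableSpace K]

open Classical in
/-- The partition of `K` into the points of `K'` and the complement of `K'`, which gets the label
`none`; it makes a measure concentrated on the countable set `K'` accessible to partitions with
countably many labels. -/
def pointPartition (K' : Set K) (k : K) : Option K' := if h : k ∈ K' then some ⟨k, h⟩ else none

omit [MeasurableSpace K] in
theorem pointPartition_preimage_some {K' : Set K} (k : K') :
    pointPartition K' ⁻¹' {some k} = {(k : K)} := by
  ext k'
  by_cases h : k' ∈ K' <;> simp [pointPartition, h, Subtype.ext_iff]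
  grind

omit [MeasurableSpace K] in
theorem pointPartition_preimage_none (K' : Set K) : pointPartition K' ⁻¹' {none} = K'ᶜ := by
  ext k
  simp [pointPartition]

omit [MeasurableSpace K] in
theorem pointPartition_preimage_image_some (K' B : Set K) :
    pointPartition K' ⁻¹' (some '' {k | (k : K) ∈ B}) = B ∩ K' := by
  ext k
  by_cases h : k ∈ K' <;> simp [pointPartition, h]

variable {κ : Measure K}

theorem exists_countable_measure_eq_one (hκ : baseEntropy κ < ⊤) :
    ∃ K' : Set K, K'.Countable ∧ κ K' = 1 := by
  by_contra h
  exact hκ.ne (if_neg h)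

theorem baseEntropy_eq_partitionEntropy_id {K' : Set K} (hK' : K'.Countable) (h : κ K' = 1) :
    baseEntropy κ = partitionEntropy κ (id : K → K) :=
  if_pos ⟨K', hK', h⟩

variable [MeasurableSingletonClass K] {K' : Set K} (hK' : K'.Countable)
include hK'

theorem isMeasurablePartition_pointPartition : IsMeasurablePartition (pointPartition K')
  | none => pointPartition_preimage_none K' ▸ hK'.measurableSet.compl
  | some k => pointPartition_preimage_some k ▸ measurableSet_singleton (k : K)

variable [IsProbabilityMeasure κ] (h : κ K' = 1)
include h

theorem partitionEntropy_pointPartition :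
    partitionEntropy κ (pointPartition K') = partitionEntropy κ (id : K → K) := by
  have hnull : κ K'ᶜ = 0 := (prob_compl_eq_zero_iff hK'.measurableSet).2 h
  unfold partitionEntropy
  rw [← (Option.some_injective K').tsum_eq, ← tsum_subtype_eq_of_support_subset (s := K')]
  · exact tsum_congr fun k => by rw [pointPartition_preimage_some, Set.preimage_id]
  · intro k hk
    by_contra hkK'
    have : κ {k} = 0 := measure_mono_null (Set.singleton_subset_iff.2 hkK') hnull
    simp [measureReal_def, this] at hk
  · rintro (_ | k) hk
    · simp [pointPartition_preimage_none, measureReal_def, hnull] at hk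
    · exact ⟨k, rfl⟩

theorem isGenerating_pointPartition {G : Type*} [Group G] :
    IsGenerating G (bernoulliMeasure G κ) (pointPartition K' ∘ canonicalPartition G K) := by
  have := hK'.to_subtype
  refine isGenerating_comp_canonicalPartition κ fun B _ => ⟨some '' {k | (k : K) ∈ B}, ?_⟩
  have hae : K' =ᵐ[κ] Set.univ := ae_eq_univ.2 ((prob_compl_eq_zero_iff hK'.measurableSet).2 h)
  rw [pointPartition_preimage_image_some]
  simpa using ((ae_eq_refl B).inter hae).symm

end Base

section BernoulliEntropy

variable {G K J : Type*} [Group G] [MeasurableSpace K] [Countable J] {S : MapSequence G}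
  (hS : S.IsSofic) {κ : Measure K} [IsProbabilityMeasure κ] {c : K → J}
  (hc : IsMeasurablePartition c) (hκ : partitionEntropy κ c < ⊤)
  (hgen : IsGenerating G (bernoulliMeasure G κ) (c ∘ canonicalPartition G K))
include hS hc hκ hgen

theorem hasSoficEntropy_bernoulliMeasure :
    HasSoficEntropy S (bernoulliMeasure G κ) (partitionEntropy κ c : EReal) := by
  have hβ : IsMeasurablePartition (c ∘ canonicalPartition G K) := hc.comp_canonicalPartition
  have hH : partitionEntropy (bernoulliMeasure G κ) (c ∘ canonicalPartition G K) < ⊤ :=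
    (partitionEntropy_congr (law_comp_canonicalPartition (G := G) κ hc)).trans_lt hκ
  have : Nonempty {F : Finset G // F.Nonempty} := ⟨{1}, Finset.singleton_nonempty 1⟩
  have meanEntropy_eq : meanEntropy S (bernoulliMeasure G κ) (c ∘ canonicalPartition G K) =
      (partitionEntropy κ c : EReal) := by
    rw [meanEntropy_eq_iInf_nonempty S hβ hH,
      iInf_congr fun F => entropyAt_bernoulliMeasure κ hS F.2 hc hκ, iInf_const]
  exact meanEntropy_eq ▸ hgen.hasSoficEntropy (bernoulliMeasure G κ) hβ hH hS

theorem hasSoficEntropy_prod_bernoulliMeasure {X ι : Type*} [MulAction G X] [MeasurableSpace X]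
    [MeasurableConstSMul G X] {μ : Measure X} [IsProbabilityMeasure μ] [SMulInvariantMeasure G X μ]
    [Countable ι] {α : X → ι} (hα : IsMeasurablePartition α) (hHα : partitionEntropy μ α < ⊤)
    (hgenα : IsGenerating G μ α) :
    HasSoficEntropy S (μ.prod (bernoulliMeasure G κ))
      (meanEntropy S μ α + (partitionEntropy κ c : EReal)) := by
  set γ := prodPartition α (c ∘ canonicalPartition G K)
  have hγ : IsMeasurablePartition γ := hα.prodPartition hc.comp_canonicalPartition
  have hH : partitionEntropy (μ.prod (bernoulliMeasure G κ)) γ < ⊤ :=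
    partitionEntropy_prodPartition_lt_top μ _ hα hc.comp_canonicalPartition hHα
      ((partitionEntropy_congr (law_comp_canonicalPartition (G := G) κ hc)).trans_lt hκ)
  have meanEntropy_eq : meanEntropy S (μ.prod (bernoulliMeasure G κ)) γ =
      meanEntropy S μ α + (partitionEntropy κ c : EReal) := by
    rw [meanEntropy_eq_iInf_nonempty S hγ hH, meanEntropy_eq_iInf_nonempty S hα hHα,
      ← EReal.coe_ennreal_toReal hκ.ne, ← iInf_add_coe, EReal.coe_ennreal_toReal hκ.ne]
    exact iInf_congr fun F => entropyAt_prod_bernoulliMeasure κ hS F.2 hc hκ μ hα hHα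
  exact meanEntropy_eq ▸ (hgenα.prodPartition hgen).hasSoficEntropy _ hγ hH hS

end BernoulliEntropy

end SoficEntropy

end

theorem mainTheorem2_general {G : Type*} [Group G] (S : MapSequence G) (hS : S.IsSofic)
    (K : Type*) [MeasurableSpace K] [MeasurableSingletonClass K]
    (κ : Measure K) [IsProbabilityMeasure κ] (hκ : baseEntropy κ < ⊤) :
    (∀ (X : Type*) [MeasurableSpace X] [MulAction G X] [MeasurableConstSMul G X]
        (μ : Measure X) [IsProbabilityMeasure μ] [SMulInvariantMeasure G X μ],
      (Countable K → ∀ (ι : Type*) [Countable ι] (α : X → ι), IsMeasurablePartition α →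
        partitionEntropy μ α < ⊤ → ∀ F : Finset G, F.Nonempty →
          entropyAt S (μ.prod (bernoulliMeasure G κ)) (prodPartition α (canonicalPartition G K)) F
              = entropyAt S μ α F + (baseEntropy κ : EReal) ∧
          (Finite ι → Finite K →
            finEntropyAt S (μ.prod (bernoulliMeasure G κ))
                (prodPartition α (canonicalPartition G K)) F
              = finEntropyAt S μ α F + (baseEntropy κ : EReal))) ∧
      ((∃ α : X → ℕ, IsFiniteEntropyGenerator G μ α) →
        ∃ c : EReal, HasSoficEntropy S μ c ∧
          HasSoficEntropy S (μ.prod (bernoulliMeasure G κ)) (c + (baseEntropy κ : EReal)))) ∧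
    HasSoficEntropy S (bernoulliMeasure G κ) (baseEntropy κ : EReal) := by
  obtain ⟨K', hK', hκK'⟩ := exists_countable_measure_eq_one hκ
  have := hK'.to_subtype
  have baseEntropy_eq := baseEntropy_eq_partitionEntropy_id hK' hκK'
  have hid : IsMeasurablePartition (id : K → K) := fun k => measurableSet_singleton k
  have hpoint := isMeasurablePartition_pointPartition hK'
  have hgen := isGenerating_pointPartition (G := G) hK' hκK'
  have hHpoint := partitionEntropy_pointPartition hK' hκK'
  rw [baseEntropy_eq] at hκ ⊢
  refine ⟨fun X _ _ _ μ _ _ => ⟨fun _ ι _ α hα hHα F hF => ⟨?_, fun _ _ => ?_⟩, ?_⟩, ?_⟩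
  · simpa only [Function.id_comp] using
      entropyAt_prod_bernoulliMeasure κ hS hF hid hκ μ hα hHα
  · have := Fintype.ofFinite K
    rw [← coe_shannonEntropy_law κ id]
    simpa only [Function.id_comp] using finEntropyAt_prod_bernoulliMeasure κ hS hF μ hα hid
  · rintro ⟨α, hα⟩
    rw [← hHpoint] at hκ ⊢
    exact ⟨meanEntropy S μ α, hα.hasSoficEntropy μ hS,
      hasSoficEntropy_prod_bernoulliMeasure hS hpoint hκ hgen hα.1 hα.2.1 hα.2.2⟩
  · rw [← hHpoint] at hκ ⊢
    exact hasSoficEntropy_bernoulliMeasure hS hpoint hκ hgen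

theorem mainTheorem2 {G : Type*} [Group G] [Countable G]
    (S : MapSequence G) (hS : S.IsSofic) :
    (∀ (K : Type*) [Countable K] [MeasurableSpace K] [DiscreteMeasurableSpace K]
        (κ : Measure K) [IsProbabilityMeasure κ], baseEntropy κ < ⊤ →
      ∀ (X : Type*) [MeasurableSpace X] [MulAction G X] [MeasurableConstSMul G X]
        (μ : Measure X) [IsProbabilityMeasure μ] [SMulInvariantMeasure G X μ],
        (∀ (ι : Type*) [Countable ι] (α : X → ι), IsMeasurablePartition α →
          partitionEntropy μ α < ⊤ → ∀ F : Finset G, F.Nonempty →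
            entropyAt S (μ.prod (bernoulliMeasure G κ)) (prodPartition α (canonicalPartition G K)) F
                = entropyAt S μ α F + (baseEntropy κ : EReal) ∧
            (Finite ι → Finite K →
              finEntropyAt S (μ.prod (bernoulliMeasure G κ)) (prodPartition α (canonicalPartition G K)) F
                = finEntropyAt S μ α F + (baseEntropy κ : EReal))) ∧
        ((∃ α : X → ℕ, IsFiniteEntropyGenerator G μ α) →
          ∃ c : EReal, HasSoficEntropy S μ c ∧
            HasSoficEntropy S (μ.prod (bernoulliMeasure G κ)) (c + (baseEntropy κ : EReal)))) ∧
    (∀ (K : Type*) [MeasurableSpace K] [StandardBorelSpace K]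
        (κ : Measure K) [IsProbabilityMeasure κ], baseEntropy κ < ⊤ →
      HasSoficEntropy S (bernoulliMeasure G κ) (baseEntropy κ : EReal)) :=
  ⟨fun K _ _ _ κ _ hκ X _ _ _ μ _ _ =>
      ((mainTheorem2_general S hS K κ hκ).1 X μ).imp_left fun h => h inferInstance,
    fun K _ _ κ _ hκ => (mainTheorem2_general.{_, _, 0, 0} S hS K κ hκ).2⟩
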